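/- An \emph{imprecise 1.5D terrain} with $n\ge 1$ vertical intervals consists of reals $x_1<\dots<x_n$ and $b_i\le t_i$ ($1\le i\le n$); write $\ell_i=\{x_i\}\times[b_i,t_i]$. A \emph{realization} is the polyline $T$ through vertices $v_i=(x_i,y_i)\in\ell_i$, taken from left to right. A \emph{discrete watchtower} for $T$ is a vertical segment of length $h\ge 0$ from a vertex $v_k$ up to $w=(x_k,y_k+h)$ such that $w$ sees every point $q$ of $T$, i.e. the segment $wq$ lies (weakly) above $T$. The \emph{visibility polygon} of a realization is the intersection of the closed upper halfplanes bounded by the lines extending its edges. \textbf{Theorem (Discrete Watchtower).} (a) For every imprecise 1.5D terrain with $n\ge 1$ intervals there is a unique shortest-path realization $\pi$, i.e. a realization of minimum Euclidean length among those that start at $(x_1,t_1)$ and end at $(x_n,t_n)$. (b) There are a program $A$ for the real RAM (unit-cost field operations and comparisons on exact real numbers; unit-cost addition, truncated subtraction and comparison of natural numbers, which are also used as addresses; no root extraction and no rounding) and a constant $C$ such that, for every $n\ge1$ and every imprecise 1.5D terrain with $n$ intervals, $A$ halts on input $n,(x_i),(b_i),(t_i)$ after at most $C\,n$ steps and outputs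 an index $k$, a real number $h$ and a realization $T$ (the list of its heights) such that: - $T$ is obtained from $\pi$ by raising its $k$-th vertex to $(x_k,t_k)$, and the vertical segment of length $h$ based at the $k$-th vertex of $T$ is a discrete watchtower for $T$; - $h$ is the smallest height of a discrete watchtower over all realizations of the terrain and all base vertices; - $h=\min_{1\le i\le n} d_i$, and $h=d_k$, where $d_i$ is the vertical distance from $(x_i,t_i)$ to the visibility polygon $P$ of $\pi$ ($d_i=0$ if $(x_i,t_i)\in P$). -/

import Mathlib

/-! ## A real RAM

A uniform-cost random access machine with two kinds of memory cells: cells holding natural numbers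
(used for counting and for addresses) and cells holding exact real numbers. Programs are finite
pieces of code in a structured language. Real cells support the four field operations and
comparisons (no rounding and no root extraction); natural number cells support addition, truncated
subtraction and comparisons (no multiplication). There is no conversion between the two kinds. -/

namespace RealRAM

/-- A memory state: simple variables and arrays, of natural numbers and of real numbers. A program
mentions only finitely many variables and finitely many arrays. -/
structure State where
  natVar : ℕ → ℕ
  realVar : ℕ → ℝ
  natArr : ℕ → ℕ → ℕ
  realArr : ℕ → ℕ → ℝ

/-- Expressions with values in the natural numbers. -/
inductive NatExpr where
  | const (c : ℕ)
  | var (v : ℕ)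
  | read (a : ℕ) (i : NatExpr)
  | add (e f : NatExpr)
  | sub (e f : NatExpr)

/-- Expressions with values in the real numbers; only rational constants are available. -/
inductive RealExpr where
  | const (q : ℚ)
  | var (v : ℕ)
  | read (a : ℕ) (i : NatExpr)
  | add (e f : RealExpr)
  | sub (e f : RealExpr)
  | mul (e f : RealExpr)
  | div (e f : RealExpr)

/-- Tests. -/
inductive Test where
  | natLe (e f : NatExpr)
  | realLe (e f : RealExpr)
  | not (b : Test)
  | and (b c : Test)

/-- Programs. -/
inductive Program where
  | skip
  | setNat (v : ℕ) (e : NatExpr)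
  | setReal (v : ℕ) (e : RealExpr)
  | writeNat (a : ℕ) (i : NatExpr) (e : NatExpr)
  | writeReal (a : ℕ) (i : NatExpr) (e : RealExpr)
  | seq (p q : Program)
  | ite (b : Test) (p q : Program)
  | while (b : Test) (p : Program)

noncomputable section

/-- The value of a natural number expression. -/
def NatExpr.eval (s : State) : NatExpr → ℕ
  | .const c => c
  | .var v => s.natVar v
  | .read a i => s.natArr a (i.eval s)
  | .add e f => e.eval s + f.eval s
  | .sub e f => e.eval s - f.eval s

/-- The number of elementary operations in a natural number expression. -/
def NatExpr.cost : NatExpr → ℕ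
  | .const _ => 1
  | .var _ => 1
  | .read _ i => i.cost + 1
  | .add e f => e.cost + f.cost + 1
  | .sub e f => e.cost + f.cost + 1

/-- The value of a real expression (division by zero returns zero). -/
def RealExpr.eval (s : State) : RealExpr → ℝ
  | .const q => (q : ℝ)
  | .var v => s.realVar v
  | .read a i => s.realArr a (i.eval s)
  | .add e f => e.eval s + f.eval s
  | .sub e f => e.eval s - f.eval s
  | .mul e f => e.eval s * f.eval s
  | .div e f => e.eval s / f.eval s

/-- The number of elementary operations in a real expression. -/
def RealExpr.cost : RealExpr → ℕ
  | .const _ => 1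
  | .var _ => 1
  | .read _ i => i.cost + 1
  | .add e f => e.cost + f.cost + 1
  | .sub e f => e.cost + f.cost + 1
  | .mul e f => e.cost + f.cost + 1
  | .div e f => e.cost + f.cost + 1

/-- The truth of a test. -/
def Test.Holds (s : State) : Test → Prop
  | .natLe e f => e.eval s ≤ f.eval s
  | .realLe e f => e.eval s ≤ f.eval s
  | .not b => ¬ b.Holds s
  | .and b c => b.Holds s ∧ c.Holds s

/-- The number of elementary operations in a test. -/
def Test.cost : Test → ℕ
  | .natLe e f => e.cost + f.cost + 1
  | .realLe e f => e.cost + f.cost + 1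
  | .not b => b.cost + 1
  | .and b c => b.cost + c.cost + 1

/-- `Exec p s s' t`: the program `p`, started in state `s`, halts in state `s'` after exactly `t`
elementary steps. -/
inductive Exec : Program → State → State → ℕ → Prop where
  | skip (s : State) : Exec .skip s s 1
  | setNat (v : ℕ) (e : NatExpr) (s : State) :
      Exec (.setNat v e) s { s with natVar := Function.update s.natVar v (e.eval s) } (e.cost + 1)
  | setReal (v : ℕ) (e : RealExpr) (s : State) :
      Exec (.setReal v e) s
        { s with realVar := Function.update s.realVar v (e.eval s) } (e.cost + 1)
  | writeNat (a : ℕ) (i : NatExpr) (e : NatExpr) (s : State) :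
      Exec (.writeNat a i e) s
        { s with natArr := Function.update s.natArr a
                    (Function.update (s.natArr a) (i.eval s) (e.eval s)) }
        (i.cost + e.cost + 1)
  | writeReal (a : ℕ) (i : NatExpr) (e : RealExpr) (s : State) :
      Exec (.writeReal a i e) s
        { s with realArr := Function.update s.realArr a
                    (Function.update (s.realArr a) (i.eval s) (e.eval s)) }
        (i.cost + e.cost + 1)
  | seq {p q : Program} {s s' s'' : State} {t u : ℕ} :
      Exec p s s' t → Exec q s' s'' u → Exec (.seq p q) s s'' (t + u)
  | iteTrue {b : Test} {p q : Program} {s s' : State} {t : ℕ} :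
      b.Holds s → Exec p s s' t → Exec (.ite b p q) s s' (b.cost + t)
  | iteFalse {b : Test} {p q : Program} {s s' : State} {t : ℕ} :
      ¬ b.Holds s → Exec q s s' t → Exec (.ite b p q) s s' (b.cost + t)
  | whileTrue {b : Test} {p : Program} {s s' s'' : State} {t u : ℕ} :
      b.Holds s → Exec p s s' t → Exec (.while b p) s' s'' u →
        Exec (.while b p) s s'' (b.cost + t + u)
  | whileFalse {b : Test} {p : Program} {s : State} :
      ¬ b.Holds s → Exec (.while b p) s s b.cost

end

end RealRAM

/-! ## Imprecise terrains and watchtowers -/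

/-- An imprecise 1.5D terrain with `n` closed vertical intervals
`{x i} × [bot i, top i]`, ordered from left to right. -/
structure ImpreciseTerrain (n : ℕ) where
  x : Fin n → ℝ
  bot : Fin n → ℝ
  top : Fin n → ℝ
  strictMono_x : StrictMono x
  bot_le_top : ∀ i, bot i ≤ top i

namespace ImpreciseTerrain

noncomputable section

variable {n : ℕ}

/-- A choice `y` of heights is a realization if every height lies in its interval. -/
def IsRealization (T : ImpreciseTerrain n) (y : Fin n → ℝ) : Prop :=
  ∀ i, T.bot i ≤ y i ∧ y i ≤ T.top i

/-- The `i`-th vertex of the polyline with heights `y`. -/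
def vertex (T : ImpreciseTerrain n) (y : Fin n → ℝ) (i : Fin n) : ℝ × ℝ := (T.x i, y i)

/-- The polyline with heights `y`, as a set of points: its vertices and the edges joining
consecutive vertices. (The vertices are listed separately for the sake of `n = 1`.) -/
def polyline (T : ImpreciseTerrain n) (y : Fin n → ℝ) : Set (ℝ × ℝ) :=
  {p | (∃ i, p = T.vertex y i) ∨
    ∃ i j : Fin n, (i : ℕ) + 1 = j ∧ p ∈ segment ℝ (T.vertex y i) (T.vertex y j)}

/-- The points `p` and `q` are visible to each other: the segment `pq` is (weakly) above the
polyline. -/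
def Sees (T : ImpreciseTerrain n) (y : Fin n → ℝ) (p q : ℝ × ℝ) : Prop :=
  ∀ r ∈ segment ℝ p q, ∀ z ∈ T.polyline y, z.1 = r.1 → z.2 ≤ r.2

/-- The point `w` guards the polyline: every point of the polyline is visible from `w`. -/
def Guards (T : ImpreciseTerrain n) (y : Fin n → ℝ) (w : ℝ × ℝ) : Prop :=
  ∀ q ∈ T.polyline y, T.Sees y w q

/-- `y` is a realization, and the vertical segment of length `h` whose lower endpoint is the `i`-th
vertex of `y` is a watchtower: its upper endpoint sees the whole realization. -/
def IsDiscreteWatchtower (T : ImpreciseTerrain n) (y : Fin n → ℝ) (i : Fin n) (h : ℝ) : Prop :=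
  T.IsRealization y ∧ 0 ≤ h ∧ T.Guards y (T.x i, y i + h)

/-- The heights of all watchtowers, based at a vertex, of all realizations. -/
def discreteWatchtowerHeights (T : ImpreciseTerrain n) : Set ℝ :=
  {h | ∃ y i, T.IsDiscreteWatchtower y i h}

/-- The Euclidean length of the polyline with heights `y`. -/
def pathLength (T : ImpreciseTerrain n) (y : Fin n → ℝ) : ℝ :=
  ∑ i : Fin n, if hi : (i : ℕ) + 1 < n then
    √((T.x ⟨i + 1, hi⟩ - T.x i) ^ 2 + (y ⟨i + 1, hi⟩ - y i) ^ 2) else 0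

/-- `y` is a realization that starts at the top of the first interval and ends at the top of the
last one. -/
def IsTopToTop (T : ImpreciseTerrain n) (y : Fin n → ℝ) : Prop :=
  T.IsRealization y ∧ (∀ i : Fin n, (i : ℕ) = 0 → y i = T.top i) ∧
    ∀ i : Fin n, (i : ℕ) + 1 = n → y i = T.top i

/-- `y` is a shortest path from the top of the first interval to the top of the last one through
all the intervals. -/
def IsShortestPath (T : ImpreciseTerrain n) (y : Fin n → ℝ) : Prop :=
  T.IsTopToTop y ∧ ∀ z, T.IsTopToTop z → T.pathLength y ≤ T.pathLength z

/-- The visibility polygon of the polyline with heights `y`: the intersection of the closed upper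
halfplanes bounded by the lines that extend the edges. -/
def visibilityPolygon (T : ImpreciseTerrain n) (y : Fin n → ℝ) : Set (ℝ × ℝ) :=
  {p | ∀ i j : Fin n, (i : ℕ) + 1 = j →
    y i + (y j - y i) / (T.x j - T.x i) * (p.1 - T.x i) ≤ p.2}

/-- The memory before the computation: `n` is in natural number variable `0`; the `x`-coordinates,
the bottoms and the tops of the intervals are in the cells `0, …, n - 1` of the real arrays `0`, `1`
and `2`; everything else is zero. -/
def input (T : ImpreciseTerrain n) : RealRAM.State where
  natVar := fun v => if v = 0 then n else 0
  realVar := fun _ => 0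
  natArr := fun _ _ => 0
  realArr := fun a k => if hk : k < n then
      (if a = 0 then T.x ⟨k, hk⟩ else if a = 1 then T.bot ⟨k, hk⟩
        else if a = 2 then T.top ⟨k, hk⟩ else 0)
    else 0

end

end ImpreciseTerrain

/-- The vertical distance from the point `p` to the set `S`; it is zero if `p` lies in `S`. -/
noncomputable def verticalDist (p : ℝ × ℝ) (S : Set (ℝ × ℝ)) : ℝ :=
  sInf {d | ∃ b, (p.1, b) ∈ S ∧ d = |b - p.2|}

/-- The memory `s` holds the discrete watchtower of height `h` at the `k`-th vertex of the
polyline with heights `y`: the number `k` (counted from `0`) is in natural number variable `1`, the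
height `h` is in real variable `0`, and the `y i` are in the cells `0, …, n - 1` of real array
`3`. -/
def HoldsWatchtower {n : ℕ} (s : RealRAM.State) (y : Fin n → ℝ) (k : Fin n) (h : ℝ) : Prop :=
  s.natVar 1 = k ∧ s.realVar 0 = h ∧ ∀ i : Fin n, s.realArr 3 i = y i

/-! Call a realization from the first top to the last top taut if it bends upwards only at tops and
downwards only at bottoms. A shortest path is taut, because at a wrong bend moving that single
vertex shortens the path (`exists_shorter`, `exists_shorter'`). Two taut paths coincide: where one
lies above the other, it is off its bottom and the other is off its top, so their difference is
convex where it is positive, and it vanishes at both ends (`IsTaut.le`). With compactness this gives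
existence and uniqueness. It also lets the program search for a taut path, which needs comparisons
of slopes but no lengths and hence no roots.

A point on the vertical line through the `i`-th vertex, and not below that vertex, sees the polyline
exactly if no line extending an edge passes above it (`guards_of_edgeLine_le`,
`Guards.edgeLine_le`). The decisive comparison is `IsTaut.edgeLine_le`: if the edge lines of any
realization pass below a point on the `i`-th vertical that is not below the `i`-th top, so do those
of the taut path. Hence a tower of height `h` at index `i` forces `d_i ≤ h`. Conversely, raising the
`k`-th vertex of the taut path to its top changes only edges incident to that vertex; on the `k`-th
vertical their lines pass through the new vertex, so a tower of height `d_k` suffices there.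

For linear time, a funnel algorithm keeps a deque of interval endpoints with increasing edge slopes
and records predecessors (`IsFunnel.push`); following them back from the last top yields a taut path
(`IsTautFrom.step`). The distances `d_i` come from the upper envelope of the edge lines to the right
of each vertex, kept in a second deque during a scan from right to left, and from the same scan of
the reflected path for the edges to the left. In both scans every deque entry is removed at most
once, which is measured by a decreasing potential (`reaches_init_while`). -/

namespace RealRAM

/-! ### Running time and correctness of loop-free programs and of loops with a potential -/

/-- A program without loops. -/
def Program.LoopFree : Program → Prop
  | .seq p q => p.LoopFree ∧ q.LoopFree
  | .ite _ p q => p.LoopFree ∧ q.LoopFree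
  | .while _ _ => False
  | _ => True

/-- An upper bound for the number of steps of a loop-free program. -/
def Program.bound : Program → ℕ
  | .skip => 1
  | .setNat _ e => e.cost + 1
  | .setReal _ e => e.cost + 1
  | .writeNat _ i e => i.cost + e.cost + 1
  | .writeReal _ i e => i.cost + e.cost + 1
  | .seq p q => p.bound + q.bound
  | .ite b p q => b.cost + (p.bound + q.bound)
  | .while _ _ => 0

open Classical in
/-- The final state of a loop-free program. -/
noncomputable def Program.run : Program → State → State
  | .skip, s => s
  | .setNat v e, s => { s with natVar := Function.update s.natVar v (e.eval s) }
  | .setReal v e, s => { s with realVar := Function.update s.realVar v (e.eval s) }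
  | .writeNat a i e, s =>
      { s with natArr := Function.update s.natArr a
                  (Function.update (s.natArr a) (i.eval s) (e.eval s)) }
  | .writeReal a i e, s =>
      { s with realArr := Function.update s.realArr a
                  (Function.update (s.realArr a) (i.eval s) (e.eval s)) }
  | .seq p q, s => q.run (p.run s)
  | .ite b p q, s => if b.Holds s then p.run s else q.run s
  | .while _ _, s => s

theorem Program.LoopFree.exec {p : Program} (hp : p.LoopFree) (s : State) :
    ∃ t, Exec p s (p.run s) t ∧ t ≤ p.bound := by
  induction p generalizing s with
  | skip => exact ⟨_, .skip s, le_rfl⟩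
  | setNat v e => exact ⟨_, .setNat v e s, le_rfl⟩
  | setReal v e => exact ⟨_, .setReal v e s, le_rfl⟩
  | writeNat a i e => exact ⟨_, .writeNat a i e s, le_rfl⟩
  | writeReal a i e => exact ⟨_, .writeReal a i e s, le_rfl⟩
  | seq p q ihp ihq =>
    obtain ⟨t, ht, htb⟩ := ihp hp.1 s
    obtain ⟨u, hu, hub⟩ := ihq hp.2 (p.run s)
    exact ⟨_, .seq ht hu, Nat.add_le_add htb hub⟩
  | ite b p q ihp ihq =>
    obtain ⟨t, ht, htb⟩ := ihp hp.1 s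
    obtain ⟨u, hu, hub⟩ := ihq hp.2 s
    by_cases hb : b.Holds s
    · refine ⟨b.cost + t, ?_, ?_⟩
      · simpa [Program.run, hb] using Exec.iteTrue (q := q) hb ht
      · simp only [Program.bound]; omega
    · refine ⟨b.cost + u, ?_, ?_⟩
      · simpa [Program.run, hb] using Exec.iteFalse (p := p) hb hu
      · simp only [Program.bound]; omega
  | _ => exact hp.elim

/-- The program halts after at most `c` steps in a state satisfying `Q`. -/
def Reaches (p : Program) (s : State) (c : ℕ) (Q : State → Prop) : Prop :=
  ∃ s' t, Exec p s s' t ∧ t ≤ c ∧ Q s'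

theorem Reaches.seq {p q : Program} {s : State} {c d : ℕ} {Q R : State → Prop}
    (hp : Reaches p s c Q) (hq : ∀ s', Q s' → Reaches q s' d R) :
    Reaches (.seq p q) s (c + d) R := by
  obtain ⟨s', t, ht, htc, hs'⟩ := hp
  obtain ⟨s'', u, hu, hud, hs''⟩ := hq s' hs'
  exact ⟨s'', t + u, .seq ht hu, Nat.add_le_add htc hud, hs''⟩

theorem Reaches.mono {p : Program} {s : State} {c d : ℕ} {Q R : State → Prop}
    (hp : Reaches p s c Q) (hcd : c ≤ d) (hQ : ∀ s', Q s' → R s') : Reaches p s d R := by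
  obtain ⟨s', t, ht, htc, hs'⟩ := hp
  exact ⟨s', t, ht, htc.trans hcd, hQ s' hs'⟩

theorem Program.LoopFree.reaches {p : Program} (hp : p.LoopFree) (s : State) :
    Reaches p s p.bound (fun s' => s' = p.run s) := by
  obtain ⟨t, ht, htb⟩ := hp.exec s
  exact ⟨_, t, ht, htb, rfl⟩

/-- A loop whose body preserves `I` and decreases `m`. -/
theorem reaches_while {b : Test} {p : Program} (hp : p.LoopFree) (I : State → Prop)
    (m : State → ℕ)
    (step : ∀ s, I s → b.Holds s → I (p.run s) ∧ m (p.run s) < m s) (s : State) (hs : I s) :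
    Reaches (.while b p) s ((b.cost + p.bound) * m s + b.cost)
      (fun s' => I s' ∧ ¬ b.Holds s') := by
  generalize hk : m s = k
  induction k using Nat.strong_induction_on generalizing s with
  | _ k ih =>
    by_cases hb : b.Holds s
    · obtain ⟨hI, hm⟩ := step s hs hb
      obtain ⟨t, ht, htb⟩ := hp.exec s
      obtain ⟨s', u, hu, hub, hs'⟩ := ih _ (hk ▸ hm) (p.run s) hI rfl
      refine ⟨s', b.cost + t + u, .whileTrue hb ht hu, ?_, hs'⟩
      have h1 : (b.cost + p.bound) * (m (p.run s) + 1) ≤ (b.cost + p.bound) * k :=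
        Nat.mul_le_mul_left _ (hk ▸ hm)
      rw [Nat.mul_add] at h1
      omega
    · exact ⟨s, b.cost, .whileFalse hb, Nat.le_add_left _ _, hs, hb⟩

/-- The factor in the time bound for an initialized loop that is repeated at most `μ * n` times. -/
def loopBound (init : Program) (b : Test) (p : Program) (μ : ℕ) : ℕ :=
  init.bound + (b.cost + p.bound) * μ + b.cost

/-- An initialized loop with a linear number of iterations takes linear time. -/
theorem reaches_init_while {init : Program} {b : Test} {p : Program} (hi : init.LoopFree)
    (hp : p.LoopFree) (I : State → Prop) (m : State → ℕ) (μ n : ℕ) (hn : 0 < n) (s : State)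
    (h0 : I (init.run s)) (hm : m (init.run s) ≤ μ * n)
    (step : ∀ s, I s → b.Holds s → I (p.run s) ∧ m (p.run s) < m s) :
    Reaches (.seq init (.while b p)) s (loopBound init b p μ * n)
      (fun s' => I s' ∧ ¬ b.Holds s') := by
  refine ((hi.reaches s).seq (d := (b.cost + p.bound) * (μ * n) + b.cost) ?_).mono ?_
    (fun _ h => h)
  · rintro s' rfl
    exact (reaches_while hp I m step _ h0).mono
      (Nat.add_le_add_right (Nat.mul_le_mul_left _ hm) _) (fun _ h => h)
  -- As `n` is positive, the one-time costs of the initialization and of the final failing test are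
  -- absorbed into multiples of `n`.
  · have h1 : init.bound ≤ init.bound * n := Nat.le_mul_of_pos_right _ hn
    have h2 : b.cost ≤ b.cost * n := Nat.le_mul_of_pos_right _ hn
    calc _ ≤ init.bound * n + ((b.cost + p.bound) * (μ * n) + b.cost * n) := by omega
      _ = _ := by rw [loopBound]; ring

end RealRAM

/-! ### Taut paths and the funnel invariant -/

namespace ImpreciseTerrain

/-- The coordinates, bottoms and tops of `n` intervals, as sequences. -/
structure IsIntervals (n : ℕ) (x b t : ℕ → ℝ) : Prop where
  lt : ∀ i j, i < j → j < n → x i < x j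
  le : ∀ i, i < n → b i ≤ t i

/-- The heights `y` form a taut path from the first top to the last top: a realization that bends
upwards only at tops and downwards only at bottoms. -/
structure IsTaut (n : ℕ) (x b t y : ℕ → ℝ) : Prop where
  bot_le : ∀ i, i < n → b i ≤ y i
  le_top : ∀ i, i < n → y i ≤ t i
  first : y 0 = t 0
  last : y (n - 1) = t (n - 1)
  concave : ∀ i, i + 2 < n → y (i + 1) < t (i + 1) →
    (y (i + 2) - y (i + 1)) / (x (i + 2) - x (i + 1)) ≤ (y (i + 1) - y i) / (x (i + 1) - x i)
  convex : ∀ i, i + 2 < n → b (i + 1) < y (i + 1) →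
    (y (i + 1) - y i) / (x (i + 1) - x i) ≤ (y (i + 2) - y (i + 1)) / (x (i + 2) - x (i + 1))

noncomputable section

/-- The height of an endpoint: number `2 * i` is the top and number `2 * i + 1` is the bottom of
the `i`-th interval. -/
def nodeHeight (b t : ℕ → ℝ) (v : ℕ) : ℝ := if v % 2 = 0 then t (v / 2) else b (v / 2)

/-- The slope of the line through two endpoints. -/
def nodeSlope (x b t : ℕ → ℝ) (u v : ℕ) : ℝ :=
  (nodeHeight b t v - nodeHeight b t u) / (x (v / 2) - x (u / 2))

/-- A ray with slope `s` from `v` passes above the bottoms before the `i`-th one, and the path to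
`v` may continue along it if it does not go below the tops. -/
def LowerFeasible (x b t : ℕ → ℝ) (P : ℕ → ℕ) (i v : ℕ) (s : ℝ) : Prop :=
  (∀ j, v / 2 < j → j < i → b j ≤ nodeHeight b t v + s * (x j - x (v / 2))) ∧
    (v % 2 = 0 → v ≠ 0 → nodeSlope x b t (P v) v ≤ s)

/-- A ray with slope `s` from `v` passes below the tops before the `i`-th one, and the path to
`v` may continue along it if it does not go above the bottoms. -/
def UpperFeasible (x b t : ℕ → ℝ) (P : ℕ → ℕ) (i v : ℕ) (s : ℝ) : Prop :=
  (∀ j, v / 2 < j → j < i → nodeHeight b t v + s * (x j - x (v / 2)) ≤ t j) ∧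
    (v % 2 = 1 → s ≤ nodeSlope x b t (P v) v)

/-- `P v` is the predecessor of the endpoint `v` on a taut path. -/
structure IsPred (x b t : ℕ → ℝ) (P : ℕ → ℕ) (v : ℕ) : Prop where
  lt : P v / 2 < v / 2
  ne_one : P v ≠ 1
  lower : LowerFeasible x b t P (v / 2) (P v) (nodeSlope x b t (P v) v)
  upper : UpperFeasible x b t P (v / 2) (P v) (nodeSlope x b t (P v) v)

/-- The endpoints `D L, …, D R`, from bottom to top, are a funnel in front of the `i`-th
interval. -/
structure IsFunnel (n : ℕ) (x b t : ℕ → ℝ) (i L R : ℕ) (D P : ℕ → ℕ) : Prop where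
  pos : 1 ≤ i
  le : i ≤ n
  left_le_right : L ≤ R
  left_large : n + 1 ≤ L + i
  node : ∀ k, L ≤ k → k ≤ R → D k ≠ 1 ∧ D k < 2 * i
  ne : ∀ k, L ≤ k → k < R → D k / 2 ≠ D (k + 1) / 2
  slope_le : ∀ k, L ≤ k → k + 1 < R →
    nodeSlope x b t (D k) (D (k + 1)) ≤ nodeSlope x b t (D (k + 1)) (D (k + 2))
  lower : ∀ k, L ≤ k → k < R →
    LowerFeasible x b t P i (D (k + 1)) (nodeSlope x b t (D k) (D (k + 1)))
  upper : ∀ k, L ≤ k → k < R →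
    UpperFeasible x b t P i (D k) (nodeSlope x b t (D k) (D (k + 1)))
  lower_end : ∀ s, b i ≤ nodeHeight b t (D L) + s * (x i - x (D L / 2)) →
    LowerFeasible x b t P i (D L) s
  upper_end : ∀ s, nodeHeight b t (D R) + s * (x i - x (D R / 2)) ≤ t i →
    UpperFeasible x b t P i (D R) s
  pred : ∀ v, 2 ≤ v → v < 2 * i → IsPred x b t P v

variable {n : ℕ} {x b t : ℕ → ℝ}

theorem nodeHeight_two_mul (i : ℕ) : nodeHeight b t (2 * i) = t i := by
  simp [nodeHeight]

theorem nodeHeight_two_mul_add_one (i : ℕ) : nodeHeight b t (2 * i + 1) = b i := by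
  have h : (2 * i + 1) / 2 = i := by omega
  simp [nodeHeight, h]

theorem nodeSlope_comm (u v : ℕ) : nodeSlope x b t u v = nodeSlope x b t v u := by
  unfold nodeSlope
  rw [← neg_sub, ← neg_sub (x (u / 2)), neg_div_neg_eq]

theorem IsIntervals.le_of_le (hT : IsIntervals n x b t) {i j : ℕ} (hij : i ≤ j) (hj : j < n) :
    x i ≤ x j := by
  rcases hij.eq_or_lt with rfl | h
  · exact le_rfl
  · exact (hT.lt _ _ h hj).le

theorem IsIntervals.ne (hT : IsIntervals n x b t) {i j : ℕ} (hij : i ≠ j) (hi : i < n)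
    (hj : j < n) : x i ≠ x j := by
  rcases hij.lt_or_gt with h | h
  · exact (hT.lt _ _ h hj).ne
  · exact (hT.lt _ _ h hi).ne'

theorem IsIntervals.nodeSlope_mul (hT : IsIntervals n x b t) {u v : ℕ} (huv : u / 2 ≠ v / 2)
    (hu : u / 2 < n) (hv : v / 2 < n) :
    nodeSlope x b t u v * (x (v / 2) - x (u / 2)) = nodeHeight b t v - nodeHeight b t u :=
  div_mul_cancel₀ _ (sub_ne_zero.2 (hT.ne huv hu hv).symm)

theorem LowerFeasible.mono (hT : IsIntervals n x b t) {P : ℕ → ℕ} {i v : ℕ} {s s' : ℝ}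
    (hi : i ≤ n) (hs : s ≤ s') (h : LowerFeasible x b t P i v s) :
    LowerFeasible x b t P i v s' := by
  refine ⟨fun j hj hji => (h.1 j hj hji).trans ?_, fun h1 h2 => (h.2 h1 h2).trans hs⟩
  have := hT.lt _ _ hj (by omega)
  gcongr

theorem UpperFeasible.mono (hT : IsIntervals n x b t) {P : ℕ → ℕ} {i v : ℕ} {s s' : ℝ}
    (hi : i ≤ n) (hs : s' ≤ s) (h : UpperFeasible x b t P i v s) :
    UpperFeasible x b t P i v s' := by
  refine ⟨fun j hj hji => le_trans ?_ (h.1 j hj hji), fun h1 => hs.trans (h.2 h1)⟩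
  have := hT.lt _ _ hj (by omega)
  gcongr

theorem LowerFeasible.congr {P P' : ℕ → ℕ} {i v : ℕ} {s : ℝ} (hP : P' v = P v)
    (h : LowerFeasible x b t P i v s) : LowerFeasible x b t P' i v s :=
  ⟨h.1, fun h1 h2 => hP ▸ h.2 h1 h2⟩

theorem UpperFeasible.congr {P P' : ℕ → ℕ} {i v : ℕ} {s : ℝ} (hP : P' v = P v)
    (h : UpperFeasible x b t P i v s) : UpperFeasible x b t P' i v s :=
  ⟨h.1, fun h1 => hP ▸ h.2 h1⟩

theorem LowerFeasible.succ {P : ℕ → ℕ} {i v : ℕ} {s : ℝ} (h : LowerFeasible x b t P i v s)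
    (hs : b i ≤ nodeHeight b t v + s * (x i - x (v / 2))) :
    LowerFeasible x b t P (i + 1) v s := by
  refine ⟨fun j hj hji => ?_, h.2⟩
  rcases (Nat.lt_succ_iff.1 hji).eq_or_lt with rfl | hlt
  · exact hs
  · exact h.1 j hj hlt

theorem UpperFeasible.succ {P : ℕ → ℕ} {i v : ℕ} {s : ℝ} (h : UpperFeasible x b t P i v s)
    (hs : nodeHeight b t v + s * (x i - x (v / 2)) ≤ t i) :
    UpperFeasible x b t P (i + 1) v s := by
  refine ⟨fun j hj hji => ?_, h.2⟩
  rcases (Nat.lt_succ_iff.1 hji).eq_or_lt with rfl | hlt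
  · exact hs
  · exact h.1 j hj hlt

variable {i L R : ℕ} {D P : ℕ → ℕ}

theorem isFunnel_init (hn : 0 < n) (D P : ℕ → ℕ) (hD : D n = 0) :
    IsFunnel n x b t 1 n n D P where
  pos := le_rfl
  le := hn
  left_le_right := le_rfl
  left_large := le_rfl
  node k h1 h2 := by
    obtain rfl : k = n := le_antisymm h2 h1
    omega
  ne k h1 h2 := by omega
  slope_le k h1 h2 := by omega
  lower k h1 h2 := by omega
  upper k h1 h2 := by omega
  lower_end s _ := by
    rw [hD]
    exact ⟨fun j h1 h2 => by omega, fun _ h => absurd rfl h⟩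
  upper_end s _ := by
    rw [hD]
    exact ⟨fun j h1 h2 => by omega, fun h => by omega⟩
  pred v h1 h2 := by omega

namespace IsFunnel

theorem div_lt (h : IsFunnel n x b t i L R D P) {k : ℕ} (h1 : L ≤ k) (h2 : k ≤ R) :
    D k / 2 < i := by
  have := (h.node k h1 h2).2
  omega

theorem line_eq (hT : IsIntervals n x b t) (h : IsFunnel n x b t i L R D P) {k : ℕ}
    (h1 : L ≤ k) (h2 : k < R) (X : ℝ) :
    nodeHeight b t (D k) + nodeSlope x b t (D k) (D (k + 1)) * (X - x (D k / 2)) =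
      nodeHeight b t (D (k + 1)) +
        nodeSlope x b t (D k) (D (k + 1)) * (X - x (D (k + 1) / 2)) := by
  have := hT.nodeSlope_mul (h.ne k h1 h2) ((h.div_lt h1 h2.le).trans_le h.le)
    ((h.div_lt (h1.trans (Nat.le_succ k)) h2).trans_le h.le)
  linarith

/-- A ray from `D R` that ends at or below the new top is not steeper than the removed edge, which
reaches the new top or passes above it. The upper certificate of that edge therefore covers every
such ray. -/
theorem pop_top (hT : IsIntervals n x b t) (h : IsFunnel n x b t i L (R + 1) D P) (hi : i < n)
    (hL : L < R + 1) (hpop : t i ≤ nodeHeight b t (D R) +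
      nodeSlope x b t (D R) (D (R + 1)) * (x i - x (D R / 2))) :
    IsFunnel n x b t i L R D P where
  pos := h.pos
  le := h.le
  left_le_right := Nat.lt_succ_iff.1 hL
  left_large := h.left_large
  node k h1 h2 := h.node k h1 (by omega)
  ne k h1 h2 := h.ne k h1 (by omega)
  slope_le k h1 h2 := h.slope_le k h1 (by omega)
  lower k h1 h2 := h.lower k h1 (by omega)
  upper k h1 h2 := h.upper k h1 (by omega)
  lower_end := h.lower_end
  upper_end s hs := by
    refine (h.upper R (by omega) (by omega)).mono hT h.le ?_
    have := hT.lt _ _ (h.div_lt (k := R) (by omega) (by omega)) hi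
    exact le_of_mul_le_mul_right (by linarith) (sub_pos.2 this)
  pred := h.pred

/-- Symmetric to `pop_top`: the removed edge passes below the new bottom, so its lower certificate,
held at `D (L + 1)`, covers all steeper rays from there. -/
theorem pop_bot (hT : IsIntervals n x b t) (h : IsFunnel n x b t i L R D P) (hi : i < n)
    (hL : L < R) (hpop : nodeHeight b t (D L) +
      nodeSlope x b t (D L) (D (L + 1)) * (x i - x (D L / 2)) ≤ b i) :
    IsFunnel n x b t i (L + 1) R D P where
  pos := h.pos
  le := h.le
  left_le_right := hL
  left_large := by have := h.left_large; omega
  node k h1 h2 := h.node k (by omega) h2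
  ne k h1 h2 := h.ne k (by omega) h2
  slope_le k h1 h2 := h.slope_le k (by omega) h2
  lower k h1 h2 := h.lower k (by omega) h2
  upper k h1 h2 := h.upper k (by omega) h2
  lower_end s hs := by
    refine (h.lower L le_rfl hL).mono hT h.le ?_
    rw [h.line_eq hT le_rfl hL] at hpop
    have := hT.lt _ _ (h.div_lt (k := L + 1) (by omega) (by omega)) hi
    exact le_of_mul_le_mul_right (by linarith) (sub_pos.2 this)
  upper_end := h.upper_end
  pred := h.pred

/-- Consecutive edges share an endpoint to the left of `x i` and slopes increase along the funnel,
so the heights over `x i` increase as well. Testing the two extreme edges thus controls all of them.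
-/
theorem line_lt (hT : IsIntervals n x b t) (h : IsFunnel n x b t i L R D P) (hi : i < n)
    {k l : ℕ} (h1 : L ≤ k) (hkl : k ≤ l) (h2 : l < R) :
    nodeHeight b t (D k) + nodeSlope x b t (D k) (D (k + 1)) * (x i - x (D k / 2)) ≤
      nodeHeight b t (D l) + nodeSlope x b t (D l) (D (l + 1)) * (x i - x (D l / 2)) := by
  induction l, hkl using Nat.le_induction with
  | base => exact le_rfl
  | succ l hkl ih =>
    refine (ih (by omega)).trans ?_
    rw [h.line_eq hT (h1.trans hkl) (by omega)]
    have := hT.lt _ _ (h.div_lt (k := l + 1) (by omega) (by omega)) hi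
    gcongr
    exact h.slope_le l (by omega) h2

/-- When neither end can be popped, the lines of all remaining edges hit the new interval, so their
certificates extend over it. The predecessors of the new top and bottom are the two ends of the
funnel. Each new tangent is feasible on one side by the end condition and on the other side by
comparison with the adjacent edge; if one endpoint is left, both tangents start there and `b i ≤ t
i` orders them. -/
theorem push (hT : IsIntervals n x b t) (h : IsFunnel n x b t i (L + 1) R D P) (hi : i < n)
    (htop : L + 1 < R → nodeHeight b t (D (R - 1)) +
      nodeSlope x b t (D (R - 1)) (D R) * (x i - x (D (R - 1) / 2)) < t i)
    (hbot : L + 1 < R → b i < nodeHeight b t (D (L + 1)) +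
      nodeSlope x b t (D (L + 1)) (D (L + 2)) * (x i - x (D (L + 1) / 2)))
    {D' P' : ℕ → ℕ} (hDt : D' (R + 1) = 2 * i) (hDb : D' L = 2 * i + 1)
    (hD : ∀ k, L + 1 ≤ k → k ≤ R → D' k = D k) (hPt : P' (2 * i) = D R)
    (hPb : P' (2 * i + 1) = D (L + 1)) (hP : ∀ v, v < 2 * i → P' v = P v) :
    IsFunnel n x b t (i + 1) L (R + 1) D' P' := by
  have hLR := h.left_le_right
  have ht2 : 2 * i / 2 = i := by omega
  have hb2 : (2 * i + 1) / 2 = i := by omega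
  have hxR := hT.lt _ _ (h.div_lt hLR le_rfl) hi
  have hxL := hT.lt _ _ (h.div_lt le_rfl hLR) hi
  have hDR := h.node R hLR le_rfl
  have hDL := h.node (L + 1) le_rfl hLR
  set st := nodeSlope x b t (D R) (2 * i) with hst
  set sb := nodeSlope x b t (D (L + 1)) (2 * i + 1) with hsb
  have hst' : nodeHeight b t (D R) + st * (x i - x (D R / 2)) = t i := by
    have := hT.nodeSlope_mul (u := D R) (v := 2 * i) (by omega) (by omega) (by omega)
    rw [ht2, nodeHeight_two_mul] at this
    linarith
  have hsb' : nodeHeight b t (D (L + 1)) + sb * (x i - x (D (L + 1) / 2)) = b i := by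
    have := hT.nodeSlope_mul (u := D (L + 1)) (v := 2 * i + 1) (by omega) (by omega) (by omega)
    rw [hb2, nodeHeight_two_mul_add_one] at this
    linarith
  have hbt := hT.le i hi
  have hline : ∀ k, L + 1 ≤ k → k < R →
      b i ≤ nodeHeight b t (D k) + nodeSlope x b t (D k) (D (k + 1)) * (x i - x (D k / 2)) ∧
      nodeHeight b t (D k) + nodeSlope x b t (D k) (D (k + 1)) * (x i - x (D k / 2)) ≤ t i := by
    intro k h1 h2
    have h3 := h.line_lt hT hi le_rfl h1 h2
    have h4 := h.line_lt hT hi h1 (by omega : k ≤ R - 1) (by omega)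
    have h5 := htop (by omega)
    rw [Nat.sub_add_cancel (by omega)] at h4
    exact ⟨(hbot (by omega)).le.trans h3, h4.trans h5.le⟩
  have hslope_top : ∀ k, k + 1 = R → L + 1 ≤ k → nodeSlope x b t (D k) (D (k + 1)) ≤ st := by
    intro k hk h1
    have h3 := (hline k h1 (by omega)).2
    rw [h.line_eq hT h1 (by omega), hk] at h3
    rw [hk]
    exact le_of_mul_le_mul_right (by linarith) (sub_pos.2 hxR)
  have hslope_bot : L + 1 < R → sb ≤ nodeSlope x b t (D (L + 1)) (D (L + 2)) := by
    intro h1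
    have h3 := (hline (L + 1) le_rfl h1).1
    exact le_of_mul_le_mul_right (by linarith) (sub_pos.2 hxL)
  have htU : UpperFeasible x b t P i (D R) st := h.upper_end _ hst'.le
  have hbL : LowerFeasible x b t P i (D (L + 1)) sb := h.lower_end _ hsb'.ge
  have htL : LowerFeasible x b t P i (D R) st := by
    rcases hLR.eq_or_lt with heq | hlt
    · rw [← heq]
      refine h.lower_end _ ?_
      rw [heq, hst']
      exact hbt
    · have := h.lower (R - 1) (by omega) (by omega)
      have h2 := hslope_top (R - 1) (by omega) (by omega)
      rw [Nat.sub_add_cancel (by omega)] at this h2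
      exact this.mono hT h.le h2
  have hbU : UpperFeasible x b t P i (D (L + 1)) sb := by
    rcases hLR.eq_or_lt with heq | hlt
    · rw [heq]
      refine h.upper_end _ ?_
      rw [← heq, hsb']
      exact hbt
    · exact (h.upper (L + 1) le_rfl hlt).mono hT h.le (hslope_bot hlt)
  have hsbt : L + 1 = R → sb ≤ st := by
    intro heq
    rw [← heq] at hst' hxR
    exact le_of_mul_le_mul_right (by linarith) (sub_pos.2 hxL)
  have hPR : P' (D R) = P (D R) := hP _ hDR.2
  have hPL : P' (D (L + 1)) = P (D (L + 1)) := hP _ hDL.2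
  have hStop : nodeSlope x b t (D' R) (D' (R + 1)) = st := by rw [hDt, hD R hLR le_rfl]
  have hSbot : nodeSlope x b t (D' L) (D' (L + 1)) = sb := by
    rw [hDb, hD _ le_rfl hLR, nodeSlope_comm]
  have hSmid : ∀ k, L + 1 ≤ k → k < R →
      nodeSlope x b t (D' k) (D' (k + 1)) = nodeSlope x b t (D k) (D (k + 1)) := by
    intro k h1 h2
    rw [hD k h1 h2.le, hD (k + 1) (by omega) h2]
  have htn : LowerFeasible x b t P' (i + 1) (2 * i) st :=
    ⟨fun j h1 h2 => by omega, fun _ _ => by rw [hPt]⟩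
  have hbn : UpperFeasible x b t P' (i + 1) (2 * i + 1) sb :=
    ⟨fun j h1 h2 => by omega, fun _ => by rw [hPb]⟩
  constructor
  · omega
  · omega
  · omega
  · have := h.left_large; omega
  · intro k h1 h2
    rcases h1.eq_or_lt with rfl | h1
    · rw [hDb]; have := h.pos; omega
    · rcases h2.eq_or_lt with rfl | h2
      · rw [hDt]; omega
      · rw [hD k h1 (by omega)]
        have := h.node k h1 (by omega)
        omega
  · intro k h1 h2
    rcases h1.eq_or_lt with rfl | h1
    · rw [hDb, hD _ le_rfl hLR]; omega
    · rcases (Nat.lt_succ_iff.1 h2).eq_or_lt with rfl | h2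
      · rw [hDt, hD _ hLR le_rfl]; omega
      · rw [hD k h1 h2.le, hD (k + 1) (by omega) h2]
        exact h.ne k h1 h2
  · intro k h1 h2
    rcases h1.eq_or_lt with rfl | h1
    · rw [hSbot]
      rcases hLR.eq_or_lt with heq | hlt
      · subst heq
        rw [hStop]
        exact hsbt rfl
      · rw [hSmid _ le_rfl hlt]
        exact hslope_bot hlt
    · rw [hSmid k h1 (by omega)]
      rcases (Nat.lt_succ_iff.1 h2 : k + 1 ≤ R).eq_or_lt with heq | hlt
      · subst heq
        rw [hStop]
        exact hslope_top k rfl h1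
      · rw [hSmid (k + 1) (by omega) hlt]
        exact h.slope_le k h1 hlt
  · intro k h1 h2
    rcases h1.eq_or_lt with rfl | h1
    · rw [hSbot, hD _ le_rfl hLR]
      exact (hbL.congr hPL).succ hsb'.ge
    · rcases (Nat.lt_succ_iff.1 h2).eq_or_lt with rfl | h2
      · rw [hStop, hDt]
        exact htn
      · rw [hSmid k h1 h2, hD (k + 1) (by omega) h2]
        refine ((h.lower k h1 h2).congr (hP _ (h.node _ (by omega) h2).2)).succ ?_
        rw [← h.line_eq hT h1 h2]
        exact (hline k h1 h2).1
  · intro k h1 h2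
    rcases h1.eq_or_lt with rfl | h1
    · rw [hSbot, hDb]
      exact hbn
    · rcases (Nat.lt_succ_iff.1 h2).eq_or_lt with rfl | h2
      · rw [hStop, hD _ hLR le_rfl]
        exact (htU.congr hPR).succ hst'.le
      · rw [hSmid k h1 h2, hD k h1 h2.le]
        exact ((h.upper k h1 h2).congr (hP _ (h.node _ h1 h2.le).2)).succ (hline k h1 h2).2
  -- The new lower end is a bottom with no interval between it and the next one, and the lower bend
  -- condition concerns tops only. Dually, the upper end is a top.
  · intro s _
    rw [hDb]
    exact ⟨fun j h1 h2 => by omega, fun h => by omega⟩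
  · intro s _
    rw [hDt]
    exact ⟨fun j h1 h2 => by omega, fun h => by omega⟩
  · intro v h1 h2
    by_cases hv : v < 2 * i
    · obtain ⟨g1, g2, g3, g4⟩ := h.pred v h1 hv
      have e := hP v hv
      have e2 := hP (P v) (by omega)
      constructor
      · rwa [e]
      · rwa [e]
      · rw [e]; exact g3.congr e2
      · rw [e]; exact g4.congr e2
    · rcases (by omega : v = 2 * i ∨ v = 2 * i + 1) with rfl | rfl
      · rw [ht2.symm] at htL htU
        constructor
        · rw [hPt]; omega
        · rw [hPt]; exact hDR.1
        · rw [hPt]; exact htL.congr hPR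
        · rw [hPt]; exact htU.congr hPR
      · rw [hb2.symm] at hbL hbU
        constructor
        · rw [hPb]; omega
        · rw [hPb]; exact hDL.1
        · rw [hPb]; exact hbL.congr hPL
        · rw [hPb]; exact hbU.congr hPL

end IsFunnel

end

end ImpreciseTerrain

/-! ### Backtracking along predecessors; uniqueness of taut paths -/

namespace ImpreciseTerrain

noncomputable section

variable {n : ℕ} {x b t : ℕ → ℝ}

/-- The heights `y i`, for `m ≤ i`, are the part of a taut path that ends at the last top; the
`m`-th vertex is on the segment from `P c` to `c`. -/
structure IsTautFrom (n : ℕ) (x b t : ℕ → ℝ) (P : ℕ → ℕ) (m c : ℕ) (y : ℕ → ℝ) : Prop where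
  lt : m < n
  node : c ≠ 1 ∧ c < 2 * n
  le_node : m ≤ c / 2
  pred_lt : m ≠ 0 → P c / 2 < m
  eq : y m = nodeHeight b t c + nodeSlope x b t (P c) c * (x m - x (c / 2))
  first : m = 0 → y 0 = t 0
  last : y (n - 1) = t (n - 1)
  mem : ∀ i, m ≤ i → i < n → b i ≤ y i ∧ y i ≤ t i
  concave : ∀ i, m ≤ i → i + 2 < n → y (i + 1) < t (i + 1) →
    (y (i + 2) - y (i + 1)) / (x (i + 2) - x (i + 1)) ≤ (y (i + 1) - y i) / (x (i + 1) - x i)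
  convex : ∀ i, m ≤ i → i + 2 < n → b (i + 1) < y (i + 1) →
    (y (i + 1) - y i) / (x (i + 1) - x i) ≤ (y (i + 2) - y (i + 1)) / (x (i + 2) - x (i + 1))
  concave_node : m ≠ 0 → m + 1 < n → y m < t m →
    (y (m + 1) - y m) / (x (m + 1) - x m) ≤ nodeSlope x b t (P c) c
  convex_node : m ≠ 0 → m + 1 < n → b m < y m →
    nodeSlope x b t (P c) c ≤ (y (m + 1) - y m) / (x (m + 1) - x m)

theorem nodeHeight_mem (hT : IsIntervals n x b t) {v : ℕ} (hv : v < 2 * n) :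
    b (v / 2) ≤ nodeHeight b t v ∧ nodeHeight b t v ≤ t (v / 2) := by
  have := hT.le (v / 2) (by omega)
  unfold nodeHeight
  split_ifs
  · exact ⟨this, le_rfl⟩
  · exact ⟨le_rfl, this⟩

theorem isTautFrom_init (hT : IsIntervals n x b t) (hn : 0 < n) {P : ℕ → ℕ} {y : ℕ → ℝ}
    (hP : ∀ v, 2 ≤ v → v < 2 * n → IsPred x b t P v) (hy : y (n - 1) = t (n - 1)) :
    IsTautFrom n x b t P (n - 1) (2 * (n - 1)) y where
  lt := by omega
  node := by omega
  le_node := by omega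
  pred_lt h := by
    have := (hP (2 * (n - 1)) (by omega) (by omega)).lt
    omega
  eq := by
    have : 2 * (n - 1) / 2 = n - 1 := by omega
    rw [nodeHeight_two_mul, this, hy]
    ring
  first h := by rw [h] at hy; exact hy
  last := hy
  mem i h1 h2 := by
    obtain rfl : i = n - 1 := by omega
    rw [hy]
    exact ⟨hT.le _ h2, le_rfl⟩
  concave i h1 h2 := by omega
  convex i h1 h2 := by omega
  concave_node h1 h2 := by omega
  convex_node h1 h2 := by omega

theorem IsTautFrom.isTaut {P : ℕ → ℕ} {c : ℕ} {y : ℕ → ℝ}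
    (h : IsTautFrom n x b t P 0 c y) : IsTaut n x b t y where
  bot_le i hi := (h.mem i (Nat.zero_le i) hi).1
  le_top i hi := (h.mem i (Nat.zero_le i) hi).2
  first := h.first rfl
  last := h.last
  concave i hi := h.concave i (Nat.zero_le i) hi
  convex i hi := h.convex i (Nat.zero_le i) hi

/-- The path stays on the segment from `P c` to `c`, which meets every interval in between, until it
reaches `P c`. It can bend only there, and the bend conditions in `IsPred` allow an upward bend at a
top and a downward bend at a bottom. -/
theorem IsTautFrom.step (hT : IsIntervals n x b t) {P : ℕ → ℕ} {m c : ℕ} {y y' : ℕ → ℝ}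
    (hP : ∀ v, 2 ≤ v → v < 2 * n → IsPred x b t P v) (h : IsTautFrom n x b t P (m + 1) c y)
    (hy : ∀ i, i ≠ m → y' i = y i)
    (hym : y' m = nodeHeight b t c + nodeSlope x b t (P c) c * (x m - x (c / 2))) :
    IsTautFrom n x b t P m (if P c / 2 = m then P c else c) y' := by
  have hmn := h.lt
  have hle := h.le_node
  have hlt := h.pred_lt (by omega)
  have hc := h.node
  obtain ⟨p1, p2, p3, p4⟩ := hP c (by omega) hc.2
  set r := nodeSlope x b t (P c) c with hr
  have hyi : ∀ i, m + 1 ≤ i → y' i = y i := fun i hi => hy i (by omega)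
  have hx := hT.lt m (m + 1) (by omega) hmn
  have hslope : (y' (m + 1) - y' m) / (x (m + 1) - x m) = r := by
    rw [hyi _ le_rfl, h.eq, hym, div_eq_iff (by linarith)]
    ring
  have hline : ∀ X, nodeHeight b t c + r * (X - x (c / 2)) =
      nodeHeight b t (P c) + r * (X - x (P c / 2)) := by
    intro X
    have := hT.nodeSlope_mul (u := P c) (v := c) (by omega) (by omega) (by omega)
    linarith
  have hconc : ∀ i, m ≤ i → i + 2 < n → y' (i + 1) < t (i + 1) →
      (y' (i + 2) - y' (i + 1)) / (x (i + 2) - x (i + 1)) ≤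
        (y' (i + 1) - y' i) / (x (i + 1) - x i) := by
    intro i h1 h2 h3
    rcases h1.eq_or_lt with rfl | h1
    · rw [hslope]
      rw [hyi _ le_rfl] at h3 ⊢
      rw [hyi _ (by omega)]
      exact h.concave_node (by omega) h2 h3
    · rw [hyi (i + 1) (by omega)] at h3 ⊢
      rw [hyi i h1, hyi (i + 2) (by omega)]
      exact h.concave i h1 h2 h3
  have hconv : ∀ i, m ≤ i → i + 2 < n → b (i + 1) < y' (i + 1) →
      (y' (i + 1) - y' i) / (x (i + 1) - x i) ≤
        (y' (i + 2) - y' (i + 1)) / (x (i + 2) - x (i + 1)) := by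
    intro i h1 h2 h3
    rcases h1.eq_or_lt with rfl | h1
    · rw [hslope]
      rw [hyi _ le_rfl] at h3 ⊢
      rw [hyi _ (by omega)]
      exact h.convex_node (by omega) h2 h3
    · rw [hyi (i + 1) (by omega)] at h3 ⊢
      rw [hyi i h1, hyi (i + 2) (by omega)]
      exact h.convex i h1 h2 h3
  have hlast : y' (n - 1) = t (n - 1) := by rw [hyi _ (by omega)]; exact h.last
  have hmem : b m ≤ y' m ∧ y' m ≤ t m → ∀ i, m ≤ i → i < n → b i ≤ y' i ∧ y' i ≤ t i := by
    intro h0 i h1 h2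
    rcases h1.eq_or_lt with rfl | h1
    · exact h0
    · rw [hyi i h1]; exact h.mem i h1 h2
  split_ifs with hcase
  · have hym' : y' m = nodeHeight b t (P c) := by
      rw [hym, hline, hcase]; ring
    have h0 := nodeHeight_mem (b := b) (t := t) hT (v := P c) (by omega)
    rw [hcase, ← hym'] at h0
    refine ⟨by omega, by omega, by omega, ?_, ?_, ?_, hlast, hmem h0, hconc, hconv, ?_, ?_⟩
    · intro hm
      have := (hP (P c) (by omega) (by omega)).lt
      omega
    · rw [hym', hcase]; ring
    · intro hm
      -- Endpoint `1`, the first bottom, is never a predecessor, so the path arrives at the first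
      -- top.
      have h1 : P c = 0 := by omega
      rw [h1, hm] at hym'
      simpa [nodeHeight] using hym'
    · intro hm h1 h2
      rw [hslope]
      by_cases hpar : P c % 2 = 0
      · rw [hym', nodeHeight, if_pos hpar, hcase] at h2
        exact absurd h2 (lt_irrefl _)
      · exact p4.2 (by omega)
    · intro hm h1 h2
      rw [hslope]
      by_cases hpar : P c % 2 = 0
      · exact p3.2 hpar (by omega)
      · rw [hym', nodeHeight, if_neg hpar, hcase] at h2
        exact absurd h2 (lt_irrefl _)
  · have h0 : b m ≤ y' m ∧ y' m ≤ t m := by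
      rw [hym, hline]
      exact ⟨p3.1 m (by omega) (by omega), p4.1 m (by omega) (by omega)⟩
    refine ⟨by omega, by omega, by omega, fun _ => by omega, hym, fun hm => by omega, hlast,
      hmem h0, hconc, hconv, fun _ _ _ => ?_, fun _ _ _ => ?_⟩
    · exact hslope.le
    · exact hslope.ge

/-- A sequence that is locally convex where it is positive, and not positive at both ends, is not
positive. -/
theorem nonpos_of_convex_of_pos {x d : ℕ → ℝ} (hx : ∀ i j, i < j → j < n → x i < x j)
    (h0 : d 0 ≤ 0) (hlast : d (n - 1) ≤ 0)
    (hd : ∀ i, i + 2 < n → 0 < d (i + 1) →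
      (d (i + 1) - d i) / (x (i + 1) - x i) ≤ (d (i + 2) - d (i + 1)) / (x (i + 2) - x (i + 1))) :
    ∀ i, i < n → d i ≤ 0 := by
  -- A positive value exceeds the one before it: otherwise the preceding value would be positive
  -- too, reached by an ascent and left without one, against convexity there.
  have key : ∀ i, i + 1 < n → 0 < d (i + 1) → d i < d (i + 1) := by
    intro i
    induction i with
    | zero => intro _ h; linarith
    | succ i ih =>
      intro hi hpos
      by_contra! hle
      have hpos' : 0 < d (i + 1) := hpos.trans_le hle
      have h1 := ih (by omega) hpos'
      have h2 := hd i (by omega) hpos'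
      have h3 := hx i (i + 1) (by omega) (by omega)
      have h4 := hx (i + 1) (i + 2) (by omega) (by omega)
      have h5 : 0 < (d (i + 1) - d i) / (x (i + 1) - x i) :=
        div_pos (by linarith) (by linarith)
      have h6 : (d (i + 2) - d (i + 1)) / (x (i + 2) - x (i + 1)) ≤ 0 :=
        div_nonpos_of_nonpos_of_nonneg (by linarith) (by linarith)
      linarith
  intro i hi
  by_contra! hpos
  -- By `key` and convexity the sequence continues to ascend once it is positive, so it could not
  -- return to a nonpositive last value.
  have hall : ∀ j, i ≤ j → j < n → 0 < d j := by
    intro j hij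
    induction j, hij using Nat.le_induction with
    | base => exact fun _ => hpos
    | succ j hij ih =>
      intro hj
      have hj0 := ih (by omega)
      obtain ⟨k, rfl⟩ : ∃ k, j = k + 1 := by
        cases j with
        | zero => linarith
        | succ k => exact ⟨k, rfl⟩
      have h1 := key k (by omega) hj0
      have h2 := hd k hj hj0
      have h3 := hx k (k + 1) (by omega) (by omega)
      have h4 := hx (k + 1) (k + 2) (by omega) hj
      have h5 : 0 < (d (k + 1) - d k) / (x (k + 1) - x k) :=
        div_pos (by linarith) (by linarith)
      have h6 := (div_pos_iff_of_pos_right (by linarith)).1 (h5.trans_le h2)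
      linarith
  exact absurd (hall (n - 1) (by omega) (by omega)) (not_lt.2 hlast)

/-- Where `z i < y i`, the path `y` is above its bottom and hence convex, while `z` is below its top
and hence concave; so `y - z` is convex there. -/
theorem IsTaut.le (hT : IsIntervals n x b t) {y z : ℕ → ℝ} (hy : IsTaut n x b t y)
    (hz : IsTaut n x b t z) : ∀ i, i < n → y i ≤ z i := by
  have := nonpos_of_convex_of_pos (n := n) (d := fun i => y i - z i) hT.lt
    (by simp [hy.first, hz.first]) (by simp [hy.last, hz.last]) ?_
  · exact fun i hi => sub_nonpos.1 (this i hi)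
  · intro i hi hpos
    have h1 := hy.convex i hi (by linarith [hz.bot_le (i + 1) (by omega)])
    have h2 := hz.concave i hi (by linarith [hy.le_top (i + 1) (by omega)])
    have e1 : ∀ a b c d e : ℝ, (a - b - (c - d)) / e = (a - c) / e - (b - d) / e := by
      intros; ring
    rw [e1, e1]
    linarith

theorem IsTaut.eq (hT : IsIntervals n x b t) {y z : ℕ → ℝ} (hy : IsTaut n x b t y)
    (hz : IsTaut n x b t z) {i : ℕ} (hi : i < n) : y i = z i :=
  le_antisymm (hy.le hT hz i hi) (hz.le hT hy i hi)

end

end ImpreciseTerrain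

/-! ### Upper envelopes of edge lines, maintained in a deque -/

namespace ImpreciseTerrain

noncomputable section

variable {n : ℕ} {x y : ℕ → ℝ}

/-- The slope of the `j`-th edge. -/
def edgeSlope (x y : ℕ → ℝ) (j : ℕ) : ℝ := (y (j + 1) - y j) / (x (j + 1) - x j)

/-- The height at `X` of the line that extends the `j`-th edge. -/
def edgeLine (x y : ℕ → ℝ) (j : ℕ) (X : ℝ) : ℝ := y j + edgeSlope x y j * (X - x j)

/-- `e` is the lowest height at the `i`-th vertex, not below this vertex, that is not below the
lines extending the edges to the right. -/
structure IsRightEnvelope (n : ℕ) (x y : ℕ → ℝ) (i : ℕ) (e : ℝ) : Prop where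
  vertex_le : y i ≤ e
  line_le : ∀ j, i ≤ j → j + 1 < n → edgeLine x y j (x i) ≤ e
  eq : e = y i ∨ ∃ j, i ≤ j ∧ j + 1 < n ∧ e = edgeLine x y j (x i)

/-- The lines `A k * X + C k`, for `F ≤ k < B`, are candidates for the upper envelope, to the left
of the `m`-th vertex, of the lines extending the edges to the right of this vertex; `Z k` is the
place where the `k`-th line meets the previous one. The line of the edge to the left of the `m`-th
vertex is about to be added. -/
structure IsEnvelopeDeque (n : ℕ) (x y : ℕ → ℝ) (m F B : ℕ) (A C Z E : ℕ → ℝ) : Prop where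
  lt : m < n
  le : F ≤ B
  nonempty : m + 1 < n → F < B
  line : ∀ k, F ≤ k → k < B →
    ∃ j, m ≤ j ∧ j + 1 < n ∧ ∀ X, A k * X + C k = edgeLine x y j X
  slope_lt : ∀ k, F ≤ k → k + 1 < B → A (k + 1) < A k
  cross : ∀ k, F ≤ k → k + 1 < B →
    ∀ X, A k * X + C k ≤ A (k + 1) * X + C (k + 1) ↔ X ≤ Z (k + 1)
  cross_lt : ∀ k, F ≤ k → k + 2 < B → Z (k + 2) < Z (k + 1)
  dominated : ∀ i, i + 1 = m → ∀ j, m ≤ j → j + 1 < n → ∀ X ≤ x i,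
    (∃ k, F ≤ k ∧ k < B ∧ edgeLine x y j X ≤ A k * X + C k) ∨
      edgeLine x y j X ≤ edgeLine x y i X
  back : ∀ i, i + 1 = m → F < B →
    y m ≤ A (B - 1) * x m + C (B - 1) ∨ edgeSlope x y i < A (B - 1)
  out : ∀ i, m ≤ i → i < n → IsRightEnvelope n x y i (E i)

theorem edgeLine_left (j : ℕ) : edgeLine x y j (x j) = y j := by simp [edgeLine]

theorem edgeLine_right (hx : ∀ i j, i < j → j < n → x i < x j) {j : ℕ} (hj : j + 1 < n) :
    edgeLine x y j (x (j + 1)) = y (j + 1) := by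
  have := hx j (j + 1) (Nat.lt_succ_self j) hj
  rw [edgeLine, edgeSlope, div_mul_cancel₀ _ (by linarith)]
  ring

theorem edgeLine_sub (j : ℕ) (X X' : ℝ) :
    edgeLine x y j X = edgeLine x y j X' + edgeSlope x y j * (X - X') := by
  simp only [edgeLine]; ring

theorem isEnvelopeDeque_init (hn : 0 < n) {B : ℕ} {A C Z E : ℕ → ℝ} (hE : E (n - 1) = y (n - 1)) :
    IsEnvelopeDeque n x y (n - 1) B B A C Z E where
  lt := by omega
  le := le_rfl
  nonempty h := by omega
  line k h1 h2 := by omega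
  slope_lt k h1 h2 := by omega
  cross k h1 h2 := by omega
  cross_lt k h1 h2 := by omega
  dominated i h0 j h1 h2 := by omega
  back i h0 h1 := by omega
  out i h1 h2 := by
    obtain rfl : i = n - 1 := by omega
    exact ⟨hE.ge, fun j h3 h4 => by omega, Or.inl hE⟩

namespace IsEnvelopeDeque

variable {m F B : ℕ} {A C Z E : ℕ → ℝ}

/-- From now on the envelope is evaluated only at or to the left of `x m`, where the second line has
overtaken the first. -/
theorem pop_front (h : IsEnvelopeDeque n x y (m + 1) F B A C Z E) (hF : F + 2 ≤ B)
    (hpop : x m ≤ Z (F + 1)) : IsEnvelopeDeque n x y (m + 1) (F + 1) B A C Z E where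
  lt := h.lt
  le := by omega
  nonempty _ := by omega
  line k h1 h2 := h.line k (by omega) h2
  slope_lt k h1 h2 := h.slope_lt k (by omega) h2
  cross k h1 h2 := h.cross k (by omega) h2
  cross_lt k h1 h2 := h.cross_lt k (by omega) h2
  dominated i hi j h1 h2 X hX := by
    obtain rfl : i = m := by omega
    rcases h.dominated i hi j h1 h2 X hX with ⟨k, h3, h4, h5⟩ | h3
    · left
      rcases h3.eq_or_lt with rfl | h3
      · exact ⟨F + 1, le_rfl, hF,
          h5.trans ((h.cross F le_rfl hF X).2 (hX.trans hpop))⟩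
      · exact ⟨k, h3, h4, h5⟩
    · exact Or.inr h3
  back i hi h1 := h.back i hi (by omega)
  out := h.out

/-- To the right of `Z B` the line before the last one is higher than the last. To the left of `Z B`
the pending line is at least as high, since it is so at `Z B` and has smaller slope. This is why
`dominated` admits the pending line. -/
theorem pop_back (h : IsEnvelopeDeque n x y (m + 1) F (B + 1) A C Z E) (hF : F + 1 ≤ B)
    (hslope : edgeSlope x y m < A B)
    (hpop : A B * Z B + C B ≤ edgeLine x y m (Z B)) :
    IsEnvelopeDeque n x y (m + 1) F B A C Z E where
  lt := h.lt
  le := by omega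
  nonempty _ := by omega
  line k h1 h2 := h.line k h1 (by omega)
  slope_lt k h1 h2 := h.slope_lt k h1 (by omega)
  cross k h1 h2 := h.cross k h1 (by omega)
  cross_lt k h1 h2 := h.cross_lt k h1 (by omega)
  dominated i hi j h1 h2 X hX := by
    obtain rfl : i = m := by omega
    obtain ⟨B, rfl⟩ : ∃ B', B = B' + 1 := ⟨B - 1, by omega⟩
    rcases h.dominated i hi j h1 h2 X hX with ⟨k, h3, h4, h5⟩ | h3
    · rcases (Nat.lt_succ_iff.1 h4).eq_or_lt with rfl | h4
      · rcases le_or_gt X (Z (B + 1)) with hZ | hZ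
        · right
          refine h5.trans ?_
          rw [edgeLine_sub i X (Z (B + 1))]
          nlinarith
        · left
          refine ⟨B, by omega, by omega, h5.trans ?_⟩
          have := (h.cross B (by omega) (by omega) X).not.2 (not_le.2 hZ)
          exact (not_le.1 this).le
      · exact Or.inl ⟨k, h3, h4, h5⟩
    · exact Or.inr h3
  back i hi h1 := by
    obtain rfl : i = m := by omega
    right
    have := h.slope_lt (B - 1) (by omega) (by omega)
    rw [Nat.sub_add_cancel (by omega)] at this
    exact hslope.trans this
  out := h.out

/-- The crossings `Z` decrease along the deque, so all of them lie to the left of `X`, where each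
line is below its predecessor. -/
theorem le_front (h : IsEnvelopeDeque n x y m F B A C Z E) {X : ℝ}
    (hF : F + 2 ≤ B → Z (F + 1) < X) {k : ℕ} (h1 : F ≤ k) (h2 : k < B) :
    A k * X + C k ≤ A F * X + C F := by
  have hZ : ∀ k, F + 1 ≤ k → k < B → Z k < X := by
    intro k hk
    induction k, hk using Nat.le_induction with
    | base => exact fun h => hF h
    | succ k hk ih =>
      intro h3
      obtain ⟨k, rfl⟩ : ∃ k', k = k' + 1 := ⟨k - 1, by omega⟩
      exact (h.cross_lt k (by omega) h3).trans (ih (by omega))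
  induction k, h1 using Nat.le_induction with
  | base => exact le_rfl
  | succ k hk ih =>
    refine le_trans ?_ (ih (by omega))
    have := (h.cross k hk h2 X).not.2 (not_le.2 (hZ (k + 1) (by omega) h2))
    exact (not_le.1 this).le

/-- Over `x m` the pending line has height `y m`, so the maximum of that height and the front line
accounts for both alternatives in `dominated`. -/
theorem isRightEnvelope (h : IsEnvelopeDeque n x y (m + 1) F B A C Z E)
    (hF : F + 2 ≤ B → Z (F + 1) < x m) :
    IsRightEnvelope n x y m
      (if F < B ∧ y m ≤ A F * x m + C F then A F * x m + C F else y m) := by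
  have hlt := h.lt
  split_ifs with hc
  · refine ⟨hc.2, ?_, Or.inr ?_⟩
    · intro j h1 h2
      rcases h1.eq_or_lt with rfl | h1
      · rw [edgeLine_left]; exact hc.2
      · rcases h.dominated m rfl j h1 h2 _ le_rfl with ⟨k, h3, h4, h5⟩ | h3
        · exact h5.trans (h.le_front hF h3 h4)
        · rw [edgeLine_left] at h3
          exact h3.trans hc.2
    · obtain ⟨j, h1, h2, h3⟩ := h.line F le_rfl hc.1
      exact ⟨j, by omega, h2, h3 _⟩
  · refine ⟨le_rfl, ?_, Or.inl rfl⟩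
    intro j h1 h2
    rcases h1.eq_or_lt with rfl | h1
    · rw [edgeLine_left]
    · rcases h.dominated m rfl j h1 h2 _ le_rfl with ⟨k, h3, h4, h5⟩ | h3
      · have h6 := h.le_front hF h3 h4
        have h7 : ¬ y m ≤ A F * x m + C F := fun h8 => hc ⟨by omega, h8⟩
        linarith
      · rwa [edgeLine_left] at h3

theorem out_step (h : IsEnvelopeDeque n x y (m + 1) F B A C Z E)
    (hF : F + 2 ≤ B → Z (F + 1) < x m) {E' : ℕ → ℝ}
    (hE : E' = Function.update E m
      (if F < B ∧ y m ≤ A F * x m + C F then A F * x m + C F else y m)) :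
    ∀ i, m ≤ i → i < n → IsRightEnvelope n x y i (E' i) := by
  intro i h1 h2
  rcases h1.eq_or_lt with rfl | h1
  · rw [hE, Function.update_self]
    exact h.isRightEnvelope hF
  · rw [hE, Function.update_of_ne (by omega)]
    exact h.out i h1 h2

/-- The pending line passes through vertex `m + 1`, which is not above the last line by the
invariant `back`. With a slope at least as large, it stays below that line further to the left and
never contributes. -/
theorem skip (hx : ∀ i j, i < j → j < n → x i < x j)
    (h : IsEnvelopeDeque n x y (m + 1) F B A C Z E) (hF : F + 2 ≤ B → Z (F + 1) < x m)
    (hB : F < B) (hslope : A (B - 1) ≤ edgeSlope x y m) {E' : ℕ → ℝ}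
    (hE : E' = Function.update E m
      (if F < B ∧ y m ≤ A F * x m + C F then A F * x m + C F else y m)) :
    IsEnvelopeDeque n x y m F B A C Z E' := by
  have hlt := h.lt
  have hback : y (m + 1) ≤ A (B - 1) * x (m + 1) + C (B - 1) :=
    (h.back m rfl hB).resolve_right (not_lt.2 hslope)
  have hdom : ∀ X ≤ x (m + 1), edgeLine x y m X ≤ A (B - 1) * X + C (B - 1) := by
    intro X hX
    rw [edgeLine_sub m X (x (m + 1)), edgeLine_right hx hlt]
    nlinarith
  refine ⟨by omega, h.le, fun _ => hB, ?_, h.slope_lt, h.cross, h.cross_lt, ?_, ?_,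
    h.out_step hF hE⟩
  · intro k h1 h2
    obtain ⟨j, h3, h4⟩ := h.line k h1 h2
    exact ⟨j, by omega, h4⟩
  · intro i hi j h1 h2 X hX
    have hXm : X ≤ x m := hX.trans (hx i m (by omega) (by omega)).le
    have hXm1 : X ≤ x (m + 1) := hXm.trans (hx m (m + 1) (by omega) (by omega)).le
    left
    rcases h1.eq_or_lt with rfl | h1
    · exact ⟨B - 1, by omega, by omega, hdom X hXm1⟩
    · rcases h.dominated m rfl j h1 h2 X hXm with h3 | h3
      · exact h3
      · exact ⟨B - 1, by omega, by omega, h3.trans (hdom X hXm1)⟩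
  · intro i hi _
    left
    rw [← edgeLine_left (x := x) (y := y) m]
    exact hdom _ (hx m (m + 1) (by omega) (by omega)).le

/-- The new line has the smallest slope, so it overtakes the last line to the left of their
crossing; the failed pop test places this crossing to the left of the previous one. For an empty
deque the quotient in `Z'` is meaningless, but the entry of `Z'` at the front is never referred to.
-/
theorem push (hx : ∀ i j, i < j → j < n → x i < x j)
    (h : IsEnvelopeDeque n x y (m + 1) F B A C Z E) (hF : F + 2 ≤ B → Z (F + 1) < x m)
    (hslope : F < B → edgeSlope x y m < A (B - 1))
    (hpop : F + 2 ≤ B → edgeLine x y m (Z (B - 1)) < A (B - 1) * Z (B - 1) + C (B - 1))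
    {A' C' Z' E' : ℕ → ℝ} (hA : A' = Function.update A B (edgeSlope x y m))
    (hC : C' = Function.update C B (y m - edgeSlope x y m * x m))
    (hZ : Z' = Function.update Z B
      ((y m - edgeSlope x y m * x m - C (B - 1)) / (A (B - 1) - edgeSlope x y m)))
    (hE : E' = Function.update E m
      (if F < B ∧ y m ≤ A F * x m + C F then A F * x m + C F else y m)) :
    IsEnvelopeDeque n x y m F (B + 1) A' C' Z' E' := by
  have hlt := h.lt
  have hle := h.le
  have hA0 : A' B = edgeSlope x y m := by rw [hA, Function.update_self]
  have hC0 : C' B = y m - edgeSlope x y m * x m := by rw [hC, Function.update_self]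
  have hA1 : ∀ k, k ≠ B → A' k = A k := fun k hk => by rw [hA, Function.update_of_ne hk]
  have hC1 : ∀ k, k ≠ B → C' k = C k := fun k hk => by rw [hC, Function.update_of_ne hk]
  have hZ1 : ∀ k, k ≠ B → Z' k = Z k := fun k hk => by rw [hZ, Function.update_of_ne hk]
  have hnew : ∀ X, A' B * X + C' B = edgeLine x y m X := by
    intro X
    rw [hA0, hC0, edgeLine]; ring
  have hcross : ∀ k, k + 1 = B → F ≤ k →
      ∀ X, A k * X + C k ≤ edgeLine x y m X ↔ X ≤ Z' (k + 1) := by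
    rintro k rfl hk X
    have h1 := hslope (by omega)
    simp only [Nat.add_sub_cancel] at h1
    rw [hZ, Function.update_self, Nat.add_sub_cancel, le_div_iff₀ (by linarith), edgeLine]
    constructor <;> intro h <;> linarith
  refine ⟨by omega, by omega, fun _ => by omega, ?_, ?_, ?_, ?_, ?_, ?_, h.out_step hF hE⟩
  · intro k h1 h2
    rcases (Nat.lt_succ_iff.1 h2).eq_or_lt with rfl | h2
    · exact ⟨m, le_rfl, hlt, hnew⟩
    · obtain ⟨j, h3, h4, h5⟩ := h.line k h1 h2
      refine ⟨j, by omega, h4, ?_⟩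
      rwa [hA1 k (by omega), hC1 k (by omega)]
  · intro k h1 h2
    rcases (Nat.lt_succ_iff.1 h2 : k + 1 ≤ B).eq_or_lt with heq | h2
    · have := hslope (by omega)
      rw [heq, hA0, hA1 k (by omega)]
      rwa [← heq, Nat.add_sub_cancel] at this
    · rw [hA1 _ (by omega), hA1 _ (by omega)]
      exact h.slope_lt k h1 h2
  · intro k h1 h2 X
    rcases (Nat.lt_succ_iff.1 h2 : k + 1 ≤ B).eq_or_lt with heq | h2
    · rw [← hcross k heq h1, heq, hnew, hA1 k (by omega), hC1 k (by omega)]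
    · rw [hA1 _ (by omega), hA1 _ (by omega), hC1 _ (by omega), hC1 _ (by omega),
        hZ1 _ (by omega)]
      exact h.cross k h1 h2 X
  · intro k h1 h2
    rcases (Nat.lt_succ_iff.1 h2 : k + 2 ≤ B).eq_or_lt with heq | h2
    · have h3 := hpop (by omega)
      have h4 := hcross (k + 1) heq (by omega) (Z (k + 1))
      rw [← heq] at h3
      simp only [Nat.add_succ_sub_one] at h3
      rw [hZ1 (k + 1) (by omega)]
      exact not_le.1 (h4.not.1 (not_le.2 h3))
    · rw [hZ1 _ (by omega), hZ1 _ (by omega)]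
      exact h.cross_lt k h1 h2
  · intro i hi j h1 h2 X hX
    have hXm : X ≤ x m := hX.trans (hx i m (by omega) (by omega)).le
    left
    rcases h1.eq_or_lt with rfl | h1
    · exact ⟨B, hle, by omega, (hnew X).ge⟩
    · rcases h.dominated m rfl j h1 h2 X hXm with ⟨k, h3, h4, h5⟩ | h3
      · refine ⟨k, h3, by omega, ?_⟩
        rwa [hA1 k (by omega), hC1 k (by omega)]
      · exact ⟨B, hle, by omega, h3.trans (hnew X).ge⟩
  · intro i hi _
    left
    rw [Nat.add_sub_cancel, hnew, edgeLine_left]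

end IsEnvelopeDeque

end

end ImpreciseTerrain

/-! ### The funnel program and the tracing of the path -/

namespace RealRAM

/-- The height at `X` of the line through the endpoints number `u` and `v`. -/
def nodeLineExpr (u v : NatExpr) (X : RealExpr) : RealExpr :=
  .add (.read 4 u) (.mul
    (.div (.sub (.read 4 v) (.read 4 u))
      (.sub (.read 0 (.read 1 v)) (.read 0 (.read 1 u))))
    (.sub X (.read 0 (.read 1 u))))

/-- Add the endpoints of the current interval to both ends of the funnel. -/
def funnelPush : Program :=
  .seq (.writeNat 1 (.add (.var 2) (.var 2)) (.var 2)) <|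
  .seq (.writeReal 4 (.add (.var 2) (.var 2)) (.read 2 (.var 2))) <|
  .seq (.writeNat 2 (.add (.var 2) (.var 2)) (.read 0 (.var 4))) <|
  .seq (.writeNat 1 (.add (.add (.var 2) (.var 2)) (.const 1)) (.var 2)) <|
  .seq (.writeReal 4 (.add (.add (.var 2) (.var 2)) (.const 1)) (.read 1 (.var 2))) <|
  .seq (.writeNat 2 (.add (.add (.var 2) (.var 2)) (.const 1)) (.read 0 (.var 3))) <|
  .seq (.setNat 3 (.sub (.var 3) (.const 1))) <|
  .seq (.setNat 4 (.add (.var 4) (.const 1))) <|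
  .seq (.writeNat 0 (.var 3) (.add (.add (.var 2) (.var 2)) (.const 1))) <|
  .seq (.writeNat 0 (.var 4) (.add (.var 2) (.var 2)))
    (.setNat 2 (.add (.var 2) (.const 1)))

/-- The last edge of the funnel passes above the top of the current interval. -/
def funnelTopTest : Test :=
  .and (.natLe (.add (.var 3) (.const 1)) (.var 4))
    (.realLe (.read 2 (.var 2))
      (nodeLineExpr (.read 0 (.sub (.var 4) (.const 1))) (.read 0 (.var 4)) (.read 0 (.var 2))))

/-- The first edge of the funnel passes below the bottom of the current interval. -/
def funnelBotTest : Test :=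
  .and (.natLe (.add (.var 3) (.const 1)) (.var 4))
    (.realLe
      (nodeLineExpr (.read 0 (.var 3)) (.read 0 (.add (.var 3) (.const 1))) (.read 0 (.var 2)))
      (.read 1 (.var 2)))

/-- One step of the funnel algorithm. -/
def funnelBody : Program :=
  .ite funnelTopTest (.setNat 4 (.sub (.var 4) (.const 1)))
    (.ite funnelBotTest (.setNat 3 (.add (.var 3) (.const 1))) funnelPush)

/-- The funnel consisting of the first top. -/
def funnelInit : Program :=
  .seq (.setNat 2 (.const 1)) <|
  .seq (.setNat 3 (.var 0)) <|
  .seq (.setNat 4 (.var 0)) <|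
  .seq (.writeNat 0 (.var 0) (.const 0)) <|
  .seq (.writeNat 1 (.const 0) (.const 0))
    (.writeReal 4 (.const 0) (.read 2 (.const 0)))

/-- The test whether there are more intervals. -/
def funnelTest : Test := .natLe (.add (.var 2) (.const 1)) (.var 0)

/-- The funnel algorithm. -/
def funnelProgram : Program := .seq funnelInit (.while funnelTest funnelBody)

/-- Choose the last top. -/
def trackInit : Program :=
  .seq (.setNat 5 (.sub (.var 0) (.const 1))) <|
  .seq (.setNat 6 (.add (.var 5) (.var 5)))
    (.writeReal 3 (.var 5) (.read 2 (.var 5)))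

/-- Write the height of the path one step to the left. -/
def trackWrite : Program :=
  .seq (.setNat 5 (.sub (.var 5) (.const 1)))
    (.writeReal 3 (.var 5)
      (.add (.read 4 (.var 6)) (.mul
        (.div (.sub (.read 4 (.var 6)) (.read 4 (.read 2 (.var 6))))
          (.sub (.read 0 (.read 1 (.var 6))) (.read 0 (.read 1 (.read 2 (.var 6))))))
        (.sub (.read 0 (.var 5)) (.read 0 (.read 1 (.var 6)))))))

/-- Follow the path one step to the left. -/
def trackBody : Program :=
  .seq trackWrite <|
  .ite (.and (.natLe (.read 1 (.read 2 (.var 6))) (.var 5))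
      (.natLe (.var 5) (.read 1 (.read 2 (.var 6)))))
    (.setNat 6 (.read 2 (.var 6))) .skip

/-- The test whether there are more vertices to the left. -/
def trackTest : Test := .natLe (.const 1) (.var 5)

/-- Write the path to array `3`, from right to left. -/
def trackProgram : Program := .seq trackInit (.while trackTest trackBody)

open ImpreciseTerrain

/-- The memory holds `n` intervals. -/
structure HoldsIntervals (n : ℕ) (x b t : ℕ → ℝ) (s : State) : Prop where
  size : s.natVar 0 = n
  x : s.realArr 0 = x
  bot : s.realArr 1 = b
  top : s.realArr 2 = t

/-- The memory holds the endpoints of the first `i` intervals. -/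
def HoldsNodes (b t : ℕ → ℝ) (i : ℕ) (s : State) : Prop :=
  ∀ v, v ≠ 1 → v < 2 * i → s.natArr 1 v = v / 2 ∧ s.realArr 4 v = nodeHeight b t v

variable {n : ℕ} {x b t : ℕ → ℝ}

theorem eval_nodeLineExpr {s : State} (hs : HoldsIntervals n x b t s) {i : ℕ}
    (hv : HoldsNodes b t i s) {u v : NatExpr} {X : RealExpr} (hu : u.eval s ≠ 1)
    (hui : u.eval s < 2 * i) (hv1 : v.eval s ≠ 1) (hvi : v.eval s < 2 * i) :
    (nodeLineExpr u v X).eval s = nodeHeight b t (u.eval s) +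
      nodeSlope x b t (u.eval s) (v.eval s) * (X.eval s - x (u.eval s / 2)) := by
  obtain ⟨h1, h2⟩ := hv _ hu hui
  obtain ⟨h3, h4⟩ := hv _ hv1 hvi
  simp only [nodeLineExpr, RealExpr.eval, NatExpr.eval, h1, h2, h3, h4, hs.x, nodeSlope]

theorem reaches_funnelProgram (hT : IsIntervals n x b t) (hn : 0 < n) {s : State}
    (hs : HoldsIntervals n x b t s) :
    Reaches funnelProgram s
      (loopBound funnelInit funnelTest funnelBody 3 * n)
      (fun s' => HoldsIntervals n x b t s' ∧ HoldsNodes b t n s' ∧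
        ∀ v, 2 ≤ v → v < 2 * n → IsPred x b t (s'.natArr 2) v) := by
  refine (reaches_init_while (by simp [funnelInit, Program.LoopFree])
    (by simp [funnelBody, funnelPush, Program.LoopFree])
    (fun s => HoldsIntervals n x b t s ∧ HoldsNodes b t (s.natVar 2) s ∧
      IsFunnel n x b t (s.natVar 2) (s.natVar 3) (s.natVar 4) (s.natArr 0) (s.natArr 2))
    -- A pop shortens the deque by one. A push lengthens it by two but processes an interval, which
    -- is worth three units.
    (fun s => 3 * (n - s.natVar 2) + (s.natVar 4 - s.natVar 3)) 3 n hn s ?_ ?_ ?_).mono le_rfl ?_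
  · obtain ⟨h0, h1, h2, h3⟩ := hs
    refine ⟨⟨?_, ?_, ?_, ?_⟩, ?_, ?_⟩
    · simpa [funnelInit, Program.run] using h0
    · simpa [funnelInit, Program.run] using h1
    · simpa [funnelInit, Program.run] using h2
    · simpa [funnelInit, Program.run] using h3
    · intro v hv1 hv2
      obtain rfl : v = 0 := by
        simp [funnelInit, Program.run, NatExpr.eval] at hv2
        omega
      simp [funnelInit, Program.run, NatExpr.eval, RealExpr.eval, nodeHeight, h3]
    · simp only [funnelInit, Program.run, NatExpr.eval]
      simp [h0]
      exact isFunnel_init hn _ _ (by simp)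
  · simp [funnelInit, Program.run, NatExpr.eval]
  · rintro s ⟨hs, hv, hF⟩ htest
    have hi : s.natVar 2 < n := by
      simpa [funnelTest, Test.Holds, NatExpr.eval, hs.size, Nat.succ_le_iff] using htest
    have htop : funnelTopTest.Holds s ↔ s.natVar 3 < s.natVar 4 ∧ t (s.natVar 2) ≤
        nodeHeight b t (s.natArr 0 (s.natVar 4 - 1)) +
          nodeSlope x b t (s.natArr 0 (s.natVar 4 - 1)) (s.natArr 0 (s.natVar 4)) *
            (x (s.natVar 2) - x (s.natArr 0 (s.natVar 4 - 1) / 2)) := by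
      simp only [funnelTopTest, Test.Holds]
      refine and_congr_right fun h => ?_
      simp only [NatExpr.eval] at h
      rw [eval_nodeLineExpr hs hv]
      · simp only [NatExpr.eval, RealExpr.eval, hs.x, hs.top]
      · exact (hF.node (s.natVar 4 - 1) (by omega) (by omega)).1
      · exact (hF.node (s.natVar 4 - 1) (by omega) (by omega)).2
      · exact (hF.node (s.natVar 4) (by omega) (by omega)).1
      · exact (hF.node (s.natVar 4) (by omega) (by omega)).2
    have hbot : funnelBotTest.Holds s ↔ s.natVar 3 < s.natVar 4 ∧
        nodeHeight b t (s.natArr 0 (s.natVar 3)) +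
          nodeSlope x b t (s.natArr 0 (s.natVar 3)) (s.natArr 0 (s.natVar 3 + 1)) *
            (x (s.natVar 2) - x (s.natArr 0 (s.natVar 3) / 2)) ≤ b (s.natVar 2) := by
      simp only [funnelBotTest, Test.Holds]
      refine and_congr_right fun h => ?_
      simp only [NatExpr.eval] at h
      rw [eval_nodeLineExpr hs hv]
      · simp only [NatExpr.eval, RealExpr.eval, hs.x, hs.bot]
      · exact (hF.node (s.natVar 3) (by omega) (by omega)).1
      · exact (hF.node (s.natVar 3) (by omega) (by omega)).2
      · exact (hF.node (s.natVar 3 + 1) (by omega) (by omega)).1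
      · exact (hF.node (s.natVar 3 + 1) (by omega) (by omega)).2
    simp only [funnelBody, Program.run]
    split_ifs with h1 h2
    · rw [htop] at h1
      obtain ⟨R, hR⟩ : ∃ R, s.natVar 4 = R + 1 := ⟨s.natVar 4 - 1, by omega⟩
      rw [hR, Nat.add_sub_cancel] at h1
      rw [hR] at hF
      refine ⟨⟨⟨?_, hs.x, hs.bot, hs.top⟩, ?_, ?_⟩, ?_⟩
      · simpa using hs.size
      · simpa [HoldsNodes] using hv
      · simpa [NatExpr.eval, hR] using hF.pop_top hT hi h1.1 h1.2
      · simp [NatExpr.eval, hR]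
        omega
    · rw [hbot] at h2
      refine ⟨⟨⟨?_, hs.x, hs.bot, hs.top⟩, ?_, ?_⟩, ?_⟩
      · simpa using hs.size
      · simpa [HoldsNodes] using hv
      · simpa [NatExpr.eval] using hF.pop_bot hT hi h2.1 h2.2
      · simp [NatExpr.eval]
        omega
    · rw [htop] at h1
      rw [hbot] at h2
      -- The deque starts at address `n`, and its left end moves down only at a push; `left_large`
      -- keeps the truncated subtraction exact.
      obtain ⟨L, hL⟩ : ∃ L, s.natVar 3 = L + 1 := ⟨s.natVar 3 - 1, by
        have := hF.left_large
        omega⟩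
      have hLR := hF.left_le_right
      rw [hL] at hF h1 h2 hLR
      refine ⟨⟨⟨?_, ?_, ?_, ?_⟩, ?_, ?_⟩, ?_⟩
      · simpa [funnelPush, Program.run] using hs.size
      · simpa [funnelPush, Program.run] using hs.x
      · simpa [funnelPush, Program.run] using hs.bot
      · simpa [funnelPush, Program.run] using hs.top
      · intro v hv1 hv2
        simp [funnelPush, Program.run, NatExpr.eval, ← two_mul] at hv2
        simp [funnelPush, Program.run, NatExpr.eval, RealExpr.eval, ← two_mul]
        by_cases hva : v = 2 * s.natVar 2 + 1
        · subst hva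
          simp [hs.bot, nodeHeight_two_mul_add_one]
          omega
        · by_cases hvb : v = 2 * s.natVar 2
          · subst hvb
            simp [hs.top, nodeHeight_two_mul]
          · simpa [hva, hvb] using hv v hv1 (by omega)
      · simp only [funnelPush, Program.run, NatExpr.eval, ← two_mul]
        simp [hL]
        refine hF.push hT hi ?_ ?_ ?_ ?_ ?_ ?_ ?_ ?_
        · exact fun h => not_le.1 fun h' => h1 ⟨h, h'⟩
        · exact fun h => not_le.1 fun h' => h2 ⟨h, h'⟩
        · simp
        · simp [Function.update_apply]
          omega
        · intro k h3 h4
          rw [Function.update_of_ne (by omega), Function.update_of_ne (by omega)]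
        · simp
        · simp
        · intro v h3
          rw [Function.update_of_ne (by omega), Function.update_of_ne (by omega)]
      · simp [funnelPush, Program.run, NatExpr.eval, hL]
        omega
  · rintro s ⟨⟨hs, hv, hF⟩, htest⟩
    have hi : s.natVar 2 = n := by
      have := hF.le
      simp [funnelTest, Test.Holds, NatExpr.eval, hs.size] at htest
      omega
    rw [hi] at hv hF
    exact ⟨hs, hv, hF.pred⟩

end RealRAM

/-! ### Correctness of the tracing of the taut path -/

namespace RealRAM

open ImpreciseTerrain

variable {n : ℕ} {x b t : ℕ → ℝ}

theorem reaches_trackProgram (hT : IsIntervals n x b t) (hn : 0 < n) {s : State}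
    (hs : HoldsIntervals n x b t s) (hv : HoldsNodes b t n s)
    (hP : ∀ v, 2 ≤ v → v < 2 * n → IsPred x b t (s.natArr 2) v) :
    Reaches trackProgram s
      (loopBound trackInit trackTest trackBody 1 * n)
      (fun s' => HoldsIntervals n x b t s' ∧ IsTaut n x b t (s'.realArr 3)) := by
  refine (reaches_init_while (by simp [trackInit, Program.LoopFree])
    (by simp [trackBody, trackWrite, Program.LoopFree])
    (fun s => HoldsIntervals n x b t s ∧ HoldsNodes b t n s ∧
      (∀ v, 2 ≤ v → v < 2 * n → IsPred x b t (s.natArr 2) v) ∧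
      IsTautFrom n x b t (s.natArr 2) (s.natVar 5) (s.natVar 6) (s.realArr 3))
    (fun s => s.natVar 5) 1 n hn s ?_ ?_ ?_).mono le_rfl ?_
  · refine ⟨⟨?_, ?_, ?_, ?_⟩, ?_, ?_, ?_⟩
    · simpa [trackInit, Program.run] using hs.size
    · simpa [trackInit, Program.run] using hs.x
    · simpa [trackInit, Program.run] using hs.bot
    · simpa [trackInit, Program.run] using hs.top
    · simpa [trackInit, Program.run, HoldsNodes] using hv
    · simpa [trackInit, Program.run] using hP
    · simp [trackInit, Program.run, NatExpr.eval, RealExpr.eval, ← two_mul, hs.size]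
      exact isTautFrom_init hT hn hP (by simp [hs.top])
  · simp [trackInit, Program.run, NatExpr.eval, hs.size]
  · rintro s ⟨hs, hv, hP, hF⟩ htest
    obtain ⟨m, hm⟩ : ∃ m, s.natVar 5 = m + 1 := ⟨s.natVar 5 - 1, by
      simp [trackTest, Test.Holds, NatExpr.eval] at htest
      omega⟩
    rw [hm] at hF
    have hc := hF.node
    have hcm := hF.le_node
    have hpred := hP (s.natVar 6) (by omega) hc.2
    have hplt := hpred.lt
    obtain ⟨h1, h2⟩ := hv _ hc.1 hc.2
    obtain ⟨h3, h4⟩ := hv _ hpred.ne_one (by omega)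
    have hstep := hF.step hT hP (y' := Function.update (s.realArr 3) m
      (nodeHeight b t (s.natVar 6) + nodeSlope x b t (s.natArr 2 (s.natVar 6)) (s.natVar 6) *
        (x m - x (s.natVar 6 / 2)))) (fun i hi => Function.update_of_ne hi _ _)
      (Function.update_self _ _ _)
    obtain ⟨s', hs'⟩ : ∃ s', s' = trackWrite.run s := ⟨_, rfl⟩
    have e1 : s'.natVar = Function.update s.natVar 5 m := by
      simp [hs', trackWrite, Program.run, NatExpr.eval, hm]
    have e2 : s'.natArr = s.natArr := by simp [hs', trackWrite, Program.run]
    have e3 : s'.realArr = Function.update s.realArr 3 (Function.update (s.realArr 3) m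
        (nodeHeight b t (s.natVar 6) + nodeSlope x b t (s.natArr 2 (s.natVar 6)) (s.natVar 6) *
          (x m - x (s.natVar 6 / 2)))) := by
      simp [hs', trackWrite, Program.run, NatExpr.eval, RealExpr.eval, hm, h1, h2, h3, h4, hs.x,
        nodeSlope]
    rw [trackBody, Program.run, ← hs', Program.run]
    split_ifs with hcase
    · simp [Test.Holds, NatExpr.eval, e1, e2, h3] at hcase
      rw [if_pos (le_antisymm hcase.1 hcase.2)] at hstep
      refine ⟨⟨⟨?_, ?_, ?_, ?_⟩, ?_, ?_, ?_⟩, ?_⟩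
      · simpa [Program.run, e1] using hs.size
      · simpa [Program.run, e3] using hs.x
      · simpa [Program.run, e3] using hs.bot
      · simpa [Program.run, e3] using hs.top
      · simpa [Program.run, e2, e3, HoldsNodes] using hv
      · simpa [Program.run, e2] using hP
      · simpa [Program.run, NatExpr.eval, e1, e2, e3] using hstep
      · simp [Program.run, e1, hm]
    · simp [Test.Holds, NatExpr.eval, e1, e2, h3] at hcase
      rw [if_neg (fun h => by have := hcase h.le; omega)] at hstep
      refine ⟨⟨⟨?_, ?_, ?_, ?_⟩, ?_, ?_, ?_⟩, ?_⟩
      · simpa [Program.run, e1] using hs.size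
      · simpa [Program.run, e3] using hs.x
      · simpa [Program.run, e3] using hs.bot
      · simpa [Program.run, e3] using hs.top
      · simpa [Program.run, e2, e3, HoldsNodes] using hv
      · simpa [Program.run, e2] using hP
      · simpa [Program.run, e1, e2, e3] using hstep
      · simp [Program.run, e1, hm]
  · rintro s ⟨⟨hs, hv, hP, hF⟩, htest⟩
    have hm : s.natVar 5 = 0 := by
      simp [trackTest, Test.Holds, NatExpr.eval] at htest
      omega
    rw [hm] at hF
    exact ⟨hs, hF.isTaut⟩

end RealRAM

/-! ### The envelope program -/

namespace RealRAM

/-- Remember the line of the edge to the left, with slope in real variable `1` and height at zero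
in real variable `2`. -/
def envelopeLoad (ax ay : ℕ) : Program :=
  .seq (.setNat 10 (.sub (.var 7) (.const 1))) <|
  .seq (.setReal 1 (.div (.sub (.read ay (.var 7)) (.read ay (.var 10)))
      (.sub (.read ax (.var 7)) (.read ax (.var 10)))))
    (.setReal 2 (.sub (.read ay (.var 10)) (.mul (.var 1) (.read ax (.var 10)))))

/-- The height at `X` of the line number `k` of the envelope. -/
def envelopeLine (k : NatExpr) (X : RealExpr) : RealExpr :=
  .add (.mul (.read 5 k) X) (.read 6 k)

/-- The first line of the envelope is no longer needed. -/
def envelopeFrontTest (ax : ℕ) : Test :=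
  .and (.natLe (.add (.var 8) (.const 2)) (.var 9))
    (.realLe (.read ax (.var 10)) (.read 7 (.add (.var 8) (.const 1))))

/-- The last line of the envelope is no longer needed. -/
def envelopeBackTest : Test :=
  .and (.natLe (.add (.var 8) (.const 2)) (.var 9)) <|
  .and (.not (.realLe (.read 5 (.sub (.var 9) (.const 1))) (.var 1)))
    (.realLe (envelopeLine (.sub (.var 9) (.const 1)) (.read 7 (.sub (.var 9) (.const 1))))
      (.add (.mul (.var 1) (.read 7 (.sub (.var 9) (.const 1)))) (.var 2)))

/-- Write the height of the envelope at the next vertex. -/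
def envelopeOut (ax ay out : ℕ) : Program :=
  .ite (.and (.natLe (.add (.var 8) (.const 1)) (.var 9))
      (.realLe (.read ay (.var 10)) (envelopeLine (.var 8) (.read ax (.var 10)))))
    (.writeReal out (.var 10) (envelopeLine (.var 8) (.read ax (.var 10))))
    (.writeReal out (.var 10) (.read ay (.var 10)))

/-- Add the new line to the envelope. -/
def envelopePush : Program :=
  .seq (.writeReal 7 (.var 9) (.div (.sub (.var 2) (.read 6 (.sub (.var 9) (.const 1))))
      (.sub (.read 5 (.sub (.var 9) (.const 1))) (.var 1)))) <|
  .seq (.writeReal 5 (.var 9) (.var 1)) <|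
  .seq (.writeReal 6 (.var 9) (.var 2))
    (.setNat 9 (.add (.var 9) (.const 1)))

/-- The slope of the new line is not smaller than the one of the last line. -/
def envelopeSkipTest : Test :=
  .and (.natLe (.add (.var 8) (.const 1)) (.var 9))
    (.realLe (.read 5 (.sub (.var 9) (.const 1))) (.var 1))

/-- One step of the computation of the envelope. -/
def envelopeBody (ax ay out : ℕ) : Program :=
  .seq (envelopeLoad ax ay) <|
  .ite (envelopeFrontTest ax) (.setNat 8 (.add (.var 8) (.const 1))) <|
  .ite envelopeBackTest (.setNat 9 (.sub (.var 9) (.const 1))) <|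
  .seq (envelopeOut ax ay out) <|
  .seq (.setNat 7 (.var 10)) <|
  .ite envelopeSkipTest .skip envelopePush

/-- Start with the last vertex and without lines. -/
def envelopeInit (ay out : ℕ) : Program :=
  .seq (.setNat 7 (.sub (.var 0) (.const 1))) <|
  .seq (.setNat 8 (.const 0)) <|
  .seq (.setNat 9 (.const 0))
    (.writeReal out (.var 7) (.read ay (.var 7)))

/-- The test whether there are more vertices to the left. -/
def envelopeTest : Test := .natLe (.const 1) (.var 7)

/-- Compute, at each vertex of the polyline in the arrays `ax` and `ay`, the upper envelope of the
lines extending the edges to the right. -/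
def envelopeProgram (ax ay out : ℕ) : Program :=
  .seq (envelopeInit ay out) (.while envelopeTest (envelopeBody ax ay out))

open ImpreciseTerrain

/-- Only the real array `out` and auxiliary real arrays have changed, and the number of intervals
is the same. -/
def EnvelopeFrame (out : ℕ) (s s' : State) : Prop :=
  s'.natVar 0 = s.natVar 0 ∧
    ∀ a, a ≠ 5 → a ≠ 6 → a ≠ 7 → a ≠ out → s'.realArr a = s.realArr a

theorem EnvelopeFrame.trans {out : ℕ} {s s' s'' : State} (h : EnvelopeFrame out s s')
    (h' : EnvelopeFrame out s' s'') : EnvelopeFrame out s s'' :=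
  ⟨h'.1.trans h.1,
    fun a h1 h2 h3 h4 => (h'.2 a h1 h2 h3 h4).trans (h.2 a h1 h2 h3 h4)⟩

variable {n : ℕ} {x y : ℕ → ℝ}

theorem reaches_envelopeProgram (hx : ∀ i j, i < j → j < n → x i < x j) (hn : 0 < n)
    {ax ay out : ℕ} (hax : ax ≠ 5 ∧ ax ≠ 6 ∧ ax ≠ 7 ∧ ax ≠ out)
    (hay : ay ≠ 5 ∧ ay ≠ 6 ∧ ay ≠ 7 ∧ ay ≠ out) (hout : 7 < out) {s₀ : State}
    (hs : s₀.natVar 0 = n) (hsx : s₀.realArr ax = x) (hsy : s₀.realArr ay = y) :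
    Reaches (envelopeProgram ax ay out) s₀
      (loopBound (envelopeInit ay out) envelopeTest (envelopeBody ax ay out) 2 * n)
      (fun s' => EnvelopeFrame out s₀ s' ∧
        ∀ i, i < n → IsRightEnvelope n x y i (s'.realArr out i)) := by
  have h5 : out ≠ 5 ∧ out ≠ 6 ∧ out ≠ 7 := by omega
  refine (reaches_init_while (by simp [envelopeInit, Program.LoopFree])
    (by simp [envelopeBody, envelopeLoad, envelopeOut, envelopePush, Program.LoopFree])
    (fun s => EnvelopeFrame out s₀ s ∧
      IsEnvelopeDeque n x y (s.natVar 7) (s.natVar 8) (s.natVar 9) (s.realArr 5) (s.realArr 6)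
        (s.realArr 7) (s.realArr out))
    -- A pop shortens the deque by one; moving to the next vertex gains two units and adds at most
    -- one line.
    (fun s => 2 * s.natVar 7 + (s.natVar 9 - s.natVar 8)) 2 n hn s₀ ?_ ?_ ?_).mono le_rfl ?_
  · refine ⟨⟨?_, ?_⟩, ?_⟩
    · simp [envelopeInit, Program.run]
    · intro a h1 h2 h3 h4
      simp [envelopeInit, Program.run, h4]
    · simp [envelopeInit, Program.run, NatExpr.eval, RealExpr.eval, hs]
      exact isEnvelopeDeque_init hn (by simp [hsy])
  · simp [envelopeInit, Program.run, NatExpr.eval, hs]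
  · rintro s ⟨hfr, hD⟩ htest
    obtain ⟨m, hm⟩ : ∃ m, s.natVar 7 = m + 1 := ⟨s.natVar 7 - 1, by
      simp [envelopeTest, Test.Holds, NatExpr.eval] at htest
      omega⟩
    rw [hm] at hD
    have hxs : s.realArr ax = x := (hfr.2 ax hax.1 hax.2.1 hax.2.2.1 hax.2.2.2).trans hsx
    have hys : s.realArr ay = y := (hfr.2 ay hay.1 hay.2.1 hay.2.2.1 hay.2.2.2).trans hsy
    obtain ⟨s', hs'⟩ : ∃ s', s' = (envelopeLoad ax ay).run s := ⟨_, rfl⟩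
    have hfr' : EnvelopeFrame out s₀ s' := by
      refine hfr.trans ⟨?_, ?_⟩ <;> simp [hs', envelopeLoad, Program.run]
    have hra : s'.realArr = s.realArr := by simp [hs', envelopeLoad, Program.run]
    have h7 : s'.natVar 7 = m + 1 := by simp [hs', envelopeLoad, Program.run, hm]
    have h8 : s'.natVar 8 = s.natVar 8 := by simp [hs', envelopeLoad, Program.run]
    have h9 : s'.natVar 9 = s.natVar 9 := by simp [hs', envelopeLoad, Program.run]
    have h10 : s'.natVar 10 = m := by
      simp [hs', envelopeLoad, Program.run, NatExpr.eval, hm]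
    have hv1 : s'.realVar 1 = edgeSlope x y m := by
      simp [hs', envelopeLoad, Program.run, NatExpr.eval, RealExpr.eval, hm, hxs, hys, edgeSlope]
    have hv2 : s'.realVar 2 = y m - edgeSlope x y m * x m := by
      simp [hs', envelopeLoad, Program.run, NatExpr.eval, RealExpr.eval, hm, hxs, hys, edgeSlope]
    rw [← h8, ← h9, ← hra] at hD
    rw [← hra] at hxs hys
    have hmeas : 2 * s.natVar 7 + (s.natVar 9 - s.natVar 8) =
        2 * (m + 1) + (s'.natVar 9 - s'.natVar 8) := by rw [h8, h9, hm]
    rw [hmeas, envelopeBody, Program.run, ← hs']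
    clear hs' hmeas hm htest hfr hra h8 h9 s
    have hle := hD.le
    have hfront : (envelopeFrontTest ax).Holds s' ↔ s'.natVar 8 + 2 ≤ s'.natVar 9 ∧
        x m ≤ s'.realArr 7 (s'.natVar 8 + 1) := by
      simp [envelopeFrontTest, Test.Holds, NatExpr.eval, RealExpr.eval, h10, hxs]
    have hline : ∀ X, edgeSlope x y m * X + (y m - edgeSlope x y m * x m) = edgeLine x y m X := by
      intro X; rw [edgeLine]; ring
    have hback : envelopeBackTest.Holds s' ↔ s'.natVar 8 + 2 ≤ s'.natVar 9 ∧
        edgeSlope x y m < s'.realArr 5 (s'.natVar 9 - 1) ∧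
        s'.realArr 5 (s'.natVar 9 - 1) * s'.realArr 7 (s'.natVar 9 - 1) +
          s'.realArr 6 (s'.natVar 9 - 1) ≤ edgeLine x y m (s'.realArr 7 (s'.natVar 9 - 1)) := by
      simp [envelopeBackTest, envelopeLine, Test.Holds, NatExpr.eval, RealExpr.eval, hv1, hv2,
        hline]
    rw [Program.run]
    split_ifs with c1
    · rw [hfront] at c1
      refine ⟨⟨?_, ?_⟩, ?_⟩
      · refine hfr'.trans ⟨?_, ?_⟩ <;> simp [Program.run]
      · simpa [Program.run, NatExpr.eval, h7] using hD.pop_front c1.1 c1.2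
      · simp [Program.run, NatExpr.eval, h7]
        omega
    rw [Program.run]
    split_ifs with c2
    · rw [hback] at c2
      refine ⟨⟨?_, ?_⟩, ?_⟩
      · refine hfr'.trans ⟨?_, ?_⟩ <;> simp [Program.run]
      · obtain ⟨B, hB⟩ : ∃ B, s'.natVar 9 = B + 1 := ⟨s'.natVar 9 - 1, by omega⟩
        rw [hB, Nat.add_sub_cancel] at c2
        rw [hB] at hD
        simpa [Program.run, NatExpr.eval, h7, hB] using hD.pop_back (by omega) c2.2.1 c2.2.2
      · simp [Program.run, NatExpr.eval, h7]
        omega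
    rw [Program.run]
    obtain ⟨s, hs⟩ : ∃ s, s = (envelopeOut ax ay out).run s' := ⟨_, rfl⟩
    rw [← hs]
    obtain ⟨e, he⟩ : ∃ e, e = if s'.natVar 8 < s'.natVar 9 ∧
        y m ≤ s'.realArr 5 (s'.natVar 8) * x m + s'.realArr 6 (s'.natVar 8) then
      s'.realArr 5 (s'.natVar 8) * x m + s'.realArr 6 (s'.natVar 8) else y m := ⟨_, rfl⟩
    have hout' : (envelopeOut ax ay out).run s' = { s' with
        realArr := Function.update s'.realArr out (Function.update (s'.realArr out) m e) } := by
      have hc : (Test.and (.natLe (.add (.var 8) (.const 1)) (.var 9))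
          (.realLe (.read ay (.var 10)) (envelopeLine (.var 8) (.read ax (.var 10))))).Holds s' ↔
          (s'.natVar 8 < s'.natVar 9 ∧
            y m ≤ s'.realArr 5 (s'.natVar 8) * x m + s'.realArr 6 (s'.natVar 8)) := by
        simp [Test.Holds, envelopeLine, NatExpr.eval, RealExpr.eval, h10, hxs, hys]
      rw [envelopeOut, Program.run, Program.run, Program.run]
      simp only [hc, he]
      split_ifs <;> simp [envelopeLine, NatExpr.eval, RealExpr.eval, h10, hxs, hys]
    rw [hout'] at hs
    clear hout'
    have c1' : s'.natVar 8 + 2 ≤ s'.natVar 9 → s'.realArr 7 (s'.natVar 8 + 1) < x m :=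
      fun h => not_le.1 fun h' => c1 (hfront.2 ⟨h, h'⟩)
    have hskip : envelopeSkipTest.Holds { s with natVar := Function.update s.natVar 7 m } ↔
        s'.natVar 8 < s'.natVar 9 ∧ s'.realArr 5 (s'.natVar 9 - 1) ≤ edgeSlope x y m := by
      simp [hs, envelopeSkipTest, Test.Holds, NatExpr.eval, RealExpr.eval, hv1, h5.1.symm]
    have hset : (Program.setNat 7 (.var 10)).run s =
        { s with natVar := Function.update s.natVar 7 m } := by
      simp [Program.run, NatExpr.eval, hs, h10]
    rw [Program.run, hset, Program.run]
    split_ifs with c3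
    · rw [hskip] at c3
      refine ⟨⟨?_, ?_⟩, ?_⟩
      · refine hfr'.trans ⟨?_, ?_⟩
        · simp [hs, Program.run]
        · intro a h1 h2 h3 h4
          simp [hs, Program.run, h4]
      · have := hD.skip hx c1' c3.1 c3.2 (congrArg _ he)
        simpa [Program.run, hs, h5.1.symm, h5.2.1.symm, h5.2.2.symm] using this
      · simp [Program.run, hs]
    · rw [hskip] at c3
      refine ⟨⟨?_, ?_⟩, ?_⟩
      · refine hfr'.trans ⟨?_, ?_⟩
        · simp [hs, envelopePush, Program.run]
        · intro a h1 h2 h3 h4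
          simp [hs, envelopePush, Program.run, h1, h2, h3, h4]
      · have := hD.push hx c1' (fun h => not_le.1 fun h' => c3 ⟨h, h'⟩)
          (fun h => not_le.1 fun h' => c2 (hback.2 ⟨h, ?_, h'⟩)) rfl rfl rfl
          (congrArg _ he)
        · simpa [envelopePush, Program.run, NatExpr.eval, RealExpr.eval, hs, h5.1, h5.2.1, h5.2.2,
            h5.1.symm, h5.2.1.symm, h5.2.2.symm, hv1, hv2] using this
        · exact not_le.1 fun h' => c3 ⟨by omega, h'⟩
      · simp [envelopePush, Program.run, NatExpr.eval, hs]
        omega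
  · rintro s ⟨⟨hfr, hD⟩, htest⟩
    have hm : s.natVar 7 = 0 := by
      simp [envelopeTest, Test.Holds, NatExpr.eval] at htest
      omega
    rw [hm] at hD
    exact ⟨hfr, fun i hi => hD.out i (Nat.zero_le i) hi⟩

end RealRAM

/-! ### Reflection, minimum search and the complete program -/

namespace RealRAM

/-- Start with the first vertex. -/
def loopInit : Program := .setNat 11 (.const 0)

/-- The test whether there are more vertices. -/
def loopTest : Test := .natLe (.add (.var 11) (.const 1)) (.var 0)

/-- The index of the vertex that is as far from the last one as the current one from the first. -/
def mirrorIndex : NatExpr := .sub (.sub (.var 0) (.const 1)) (.var 11)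

/-- Write one vertex of the reflected polyline. -/
def mirrorBody : Program :=
  .seq (.writeReal 10 (.var 11) (.sub (.const 0) (.read 0 mirrorIndex))) <|
  .seq (.writeReal 11 (.var 11) (.read 3 mirrorIndex))
    (.setNat 11 (.add (.var 11) (.const 1)))

/-- Reflect the polyline. -/
def mirrorProgram : Program := .seq loopInit (.while loopTest mirrorBody)

/-- Compute the vertical distance from the current top to the visibility polygon. -/
def distanceBody : Program :=
  .seq (.setReal 3 (.sub (.read 8 (.var 11)) (.read 2 (.var 11)))) <|
  .seq (.setReal 4 (.sub (.read 9 mirrorIndex) (.read 2 (.var 11)))) <|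
  .seq (.ite (.realLe (.var 4) (.var 3)) .skip (.setReal 3 (.var 4)))
    (.ite (.realLe (.const 0) (.var 3)) .skip (.setReal 3 (.const 0)))

/-- Keep the smaller one of the current distance and the previous ones. -/
def keepBody : Program :=
  .seq (.ite (.and (.natLe (.const 1) (.var 11)) (.realLe (.var 0) (.var 3))) .skip
      (.seq (.setReal 0 (.var 3)) (.setNat 1 (.var 11))))
    (.setNat 11 (.add (.var 11) (.const 1)))

/-- Find the smallest distance. -/
def minimumProgram : Program := .seq loopInit (.while loopTest (.seq distanceBody keepBody))

/-- Raise the base of the watchtower. -/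
def raiseProgram : Program := .writeReal 3 (.var 1) (.read 2 (.var 1))

/-- Compute an optimistic shortest discrete watchtower. -/
def watchtowerProgram : Program :=
  .seq funnelProgram <| .seq trackProgram <| .seq (envelopeProgram 0 3 8) <|
  .seq mirrorProgram <| .seq (envelopeProgram 10 11 9) <| .seq minimumProgram raiseProgram

open ImpreciseTerrain

variable {n : ℕ} {x b t : ℕ → ℝ}

theorem reaches_mirrorProgram (hn : 0 < n) {s₀ : State} (hs : s₀.natVar 0 = n) :
    Reaches mirrorProgram s₀
      (loopBound loopInit loopTest mirrorBody 1 * n)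
      (fun s' => s'.natVar 0 = n ∧ (∀ a, a ≠ 10 → a ≠ 11 → s'.realArr a = s₀.realArr a) ∧
        ∀ i, i < n → s'.realArr 10 i = - s₀.realArr 0 (n - 1 - i) ∧
          s'.realArr 11 i = s₀.realArr 3 (n - 1 - i)) := by
  refine (reaches_init_while (by simp [loopInit, Program.LoopFree])
    (by simp [mirrorBody, Program.LoopFree])
    (fun s => s.natVar 11 ≤ n ∧ s.natVar 0 = n ∧
      (∀ a, a ≠ 10 → a ≠ 11 → s.realArr a = s₀.realArr a) ∧
        ∀ i, i < s.natVar 11 → s.realArr 10 i = - s₀.realArr 0 (n - 1 - i) ∧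
          s.realArr 11 i = s₀.realArr 3 (n - 1 - i))
    (fun s => n - s.natVar 11) 1 n hn s₀ ?_ ?_ ?_).mono le_rfl ?_
  · simp [loopInit, Program.run, NatExpr.eval, hs]
  · simp [loopInit, Program.run, NatExpr.eval]
  · rintro s ⟨h1, h2, h3, h4⟩ htest
    have hi : s.natVar 11 < n := by
      simpa [loopTest, Test.Holds, NatExpr.eval, h2, Nat.succ_le_iff] using htest
    refine ⟨⟨?_, ?_, ?_, ?_⟩, ?_⟩
    · simpa [mirrorBody, Program.run, NatExpr.eval] using hi
    · simpa [mirrorBody, Program.run] using h2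
    · intro a ha hb
      simpa [mirrorBody, Program.run, ha, hb] using h3 a ha hb
    · intro i hlt
      simp only [mirrorBody, Program.run, NatExpr.eval, Function.update_self, Nat.lt_succ_iff]
        at hlt
      rcases hlt.eq_or_lt with rfl | hlt
      · simp [mirrorBody, mirrorIndex, Program.run, NatExpr.eval, RealExpr.eval, h2,
          h3 0 (by decide) (by decide), h3 3 (by decide) (by decide)]
      · simpa [mirrorBody, Program.run, NatExpr.eval, hlt.ne] using h4 i hlt
    · simp [mirrorBody, Program.run, NatExpr.eval]
      omega
  · rintro s ⟨⟨h1, h2, h3, h4⟩, htest⟩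
    have hi : s.natVar 11 = n := by
      simp [loopTest, Test.Holds, NatExpr.eval, h2] at htest
      omega
    rw [hi] at h4
    exact ⟨h2, h3, h4⟩

/-- The vertical distance from the `i`-th top to the visibility polygon, where `e` and `e'` are the
upper envelopes of the edges to the right and to the left. -/
noncomputable def envelopeDist (n : ℕ) (t e e' : ℕ → ℝ) (i : ℕ) : ℝ :=
  max 0 (max (e i - t i) (e' (n - 1 - i) - t i))

theorem Program.run_seq (p q : Program) (s : State) :
    (Program.seq p q).run s = q.run (p.run s) := rfl

open Classical in
theorem Program.run_ite (c : Test) (p q : Program) (s : State) :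
    (Program.ite c p q).run s = if c.Holds s then p.run s else q.run s := rfl

theorem run_distanceBody (s : State) :
    (distanceBody.run s).natVar = s.natVar ∧ (distanceBody.run s).realArr = s.realArr ∧
    (distanceBody.run s).realVar 0 = s.realVar 0 ∧ (distanceBody.run s).realVar 3 =
      envelopeDist (s.natVar 0) (s.realArr 2) (s.realArr 8) (s.realArr 9) (s.natVar 11) := by
  obtain ⟨s', hs'⟩ : ∃ s', s' = (Program.setReal 4 (.sub (.read 9 mirrorIndex)
    (.read 2 (.var 11)))).run ((Program.setReal 3 (.sub (.read 8 (.var 11))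
      (.read 2 (.var 11)))).run s) := ⟨_, rfl⟩
  have h0 : s'.realVar 0 = s.realVar 0 := by simp [hs', Program.run]
  have h3 : s'.realVar 3 = s.realArr 8 (s.natVar 11) - s.realArr 2 (s.natVar 11) := by
    simp [hs', Program.run, NatExpr.eval, RealExpr.eval]
  have h4 : s'.realVar 4 =
      s.realArr 9 (s.natVar 0 - 1 - s.natVar 11) - s.realArr 2 (s.natVar 11) := by
    simp [hs', Program.run, NatExpr.eval, RealExpr.eval, mirrorIndex]
  have hn : s'.natVar = s.natVar := by simp [hs', Program.run]
  have ha : s'.realArr = s.realArr := by simp [hs', Program.run]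
  obtain ⟨s₂, hs₂⟩ : ∃ s₂, s₂ = (Program.ite (.realLe (.var 4) (.var 3)) .skip
    (.setReal 3 (.var 4))).run s' := ⟨_, rfl⟩
  have g3 : s₂.realVar 3 = max (s'.realVar 3) (s'.realVar 4) := by
    rw [hs₂, Program.run]
    split_ifs with h <;> simp only [Test.Holds, RealExpr.eval] at h
    · simp [Program.run, h]
    · simp [Program.run, RealExpr.eval, (not_le.1 h).le]
  have g0 : s₂.realVar 0 = s'.realVar 0 := by
    rw [hs₂, Program.run]
    split_ifs <;> simp [Program.run]
  have gn : s₂.natVar = s'.natVar := by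
    rw [hs₂, Program.run]
    split_ifs <;> simp [Program.run]
  have ga : s₂.realArr = s'.realArr := by
    rw [hs₂, Program.run]
    split_ifs <;> simp [Program.run]
  rw [h3, h4] at g3
  rw [distanceBody, Program.run_seq, Program.run_seq, Program.run_seq, ← hs', ← hs₂,
    Program.run_ite, envelopeDist, ← g3, ← h0, ← g0, ← hn, ← gn, ← ha, ← ga]
  clear hs₂
  split_ifs with h <;> simp only [Test.Holds, RealExpr.eval, Rat.cast_zero] at h
  · simp [Program.run, h]
  · simp [Program.run, RealExpr.eval, (not_le.1 h).le]

theorem reaches_minimumProgram (hn : 0 < n) {s₀ : State} (hs : s₀.natVar 0 = n) :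
    Reaches minimumProgram s₀
      (loopBound loopInit loopTest (.seq distanceBody keepBody) 1 * n)
      (fun s' => s'.realArr = s₀.realArr ∧ s'.natVar 1 < n ∧
        s'.realVar 0 = envelopeDist n (s₀.realArr 2) (s₀.realArr 8) (s₀.realArr 9) (s'.natVar 1) ∧
        ∀ i, i < n → s'.realVar 0 ≤
          envelopeDist n (s₀.realArr 2) (s₀.realArr 8) (s₀.realArr 9) i) := by
  refine (reaches_init_while (by simp [loopInit, Program.LoopFree])
    (by simp [distanceBody, keepBody, Program.LoopFree])
    (fun s => s.natVar 11 ≤ n ∧ s.natVar 0 = n ∧ s.realArr = s₀.realArr ∧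
      -- Before the first vertex is processed, the stored minimum has no meaning; at index `0` it is
      -- overwritten unconditionally.
      (0 < s.natVar 11 → s.natVar 1 < n ∧ s.realVar 0 =
        envelopeDist n (s₀.realArr 2) (s₀.realArr 8) (s₀.realArr 9) (s.natVar 1)) ∧
        ∀ i, i < s.natVar 11 → s.realVar 0 ≤
          envelopeDist n (s₀.realArr 2) (s₀.realArr 8) (s₀.realArr 9) i)
    (fun s => n - s.natVar 11) 1 n hn s₀ ?_ ?_ ?_).mono le_rfl ?_
  · simp [loopInit, Program.run, NatExpr.eval, hs]
  · simp [loopInit, Program.run, NatExpr.eval]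
  · rintro s ⟨h1, h2, h3, h4, h5⟩ htest
    have hi : s.natVar 11 < n := by
      simpa [loopTest, Test.Holds, NatExpr.eval, h2, Nat.succ_le_iff] using htest
    obtain ⟨g1, g2, g3, g4⟩ := run_distanceBody s
    rw [Program.run]
    generalize distanceBody.run s = s' at g1 g2 g3 g4
    rw [h2, h3] at g4
    rw [← g1] at h1 h2 h4 h5 hi g4
    rw [← g2] at h3
    rw [← g3] at h4 h5
    rw [← g1]
    clear g1 g2 g3 htest s
    rw [keepBody, Program.run_seq, Program.run_ite]
    split_ifs with hc <;> simp only [Test.Holds, NatExpr.eval, RealExpr.eval] at hc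
    · refine ⟨⟨?_, ?_, ?_, ?_, ?_⟩, ?_⟩
      · simpa [Program.run, NatExpr.eval] using hi
      · simpa [Program.run] using h2
      · simpa [Program.run] using h3
      · simpa [Program.run] using fun _ => h4 hc.1
      · intro i hlt
        simp only [Program.run, NatExpr.eval, Function.update_self, Nat.lt_succ_iff] at hlt
        rcases hlt.eq_or_lt with rfl | hlt
        · simpa [Program.run, ← g4] using hc.2
        · simpa [Program.run] using h5 i hlt
      · simp [Program.run, NatExpr.eval]
        omega
    · refine ⟨⟨?_, ?_, ?_, ?_, ?_⟩, ?_⟩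
      · simpa [Program.run, NatExpr.eval] using hi
      · simpa [Program.run] using h2
      · simpa [Program.run] using h3
      · simp [Program.run, NatExpr.eval, RealExpr.eval, hi, g4]
      · intro i hlt
        simp [Program.run, NatExpr.eval] at hlt
        rcases hlt.eq_or_lt with rfl | hlt
        · simp [Program.run, RealExpr.eval, ← g4]
        · have : s'.realVar 3 < s'.realVar 0 := not_le.1 fun h => hc ⟨by omega, h⟩
          simpa [Program.run, RealExpr.eval] using this.le.trans (h5 i hlt)
      · simp [Program.run, NatExpr.eval]
        omega
  · rintro s ⟨⟨h1, h2, h3, h4, h5⟩, htest⟩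
    have hi : s.natVar 11 = n := by
      simp [loopTest, Test.Holds, NatExpr.eval, h2] at htest
      omega
    rw [hi] at h4 h5
    exact ⟨h3, (h4 hn).1, (h4 hn).2, h5⟩

/-- The result of the computation: a taut path `y`, and the index `k` of the top with the smallest
distance to the visibility polygon. -/
def HoldsResult (n : ℕ) (x b t : ℕ → ℝ) (s : State) : Prop :=
  ∃ (y e e' x' y' : ℕ → ℝ) (k : ℕ), IsTaut n x b t y ∧
    (∀ i, i < n → IsRightEnvelope n x y i (e i)) ∧
    (∀ i, i < n → x' i = - x (n - 1 - i) ∧ y' i = y (n - 1 - i)) ∧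
    (∀ i, i < n → IsRightEnvelope n x' y' i (e' i)) ∧ k < n ∧ s.natVar 1 = k ∧
    s.realVar 0 = envelopeDist n t e e' k ∧
    (∀ i, i < n → envelopeDist n t e e' k ≤ envelopeDist n t e e' i) ∧
    s.realArr 3 = Function.update y k (t k)

theorem exists_reaches_watchtowerProgram : ∃ C : ℕ, ∀ (n : ℕ) (x b t : ℕ → ℝ) (s : State),
    IsIntervals n x b t → 0 < n → HoldsIntervals n x b t s →
      Reaches watchtowerProgram s (C * n) (HoldsResult n x b t) := by
  refine ⟨loopBound funnelInit funnelTest funnelBody 3 + (loopBound trackInit trackTest trackBody 1 +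
    (loopBound (envelopeInit 3 8) envelopeTest (envelopeBody 0 3 8) 2 +
    (loopBound loopInit loopTest mirrorBody 1 +
    (loopBound (envelopeInit 11 9) envelopeTest (envelopeBody 10 11 9) 2 +
    (loopBound loopInit loopTest (.seq distanceBody keepBody) 1 + raiseProgram.bound))))),
    fun n x b t s hT hn hs => ?_⟩
  simp only [Nat.add_mul]
  refine (reaches_funnelProgram hT hn hs).seq fun s₁ ⟨hs₁, hv, hP⟩ => ?_
  refine (reaches_trackProgram hT hn hs₁ hv hP).seq fun s₂ ⟨hs₂, hy⟩ => ?_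
  refine (reaches_envelopeProgram hT.lt hn (by decide) (by decide) (by decide) hs₂.size hs₂.x
    rfl).seq fun s₃ ⟨hf₃, he₃⟩ => ?_
  refine (reaches_mirrorProgram hn (hf₃.1.trans hs₂.size)).seq fun s₄ ⟨hn₄, hf₄, hm₄⟩ => ?_
  have hx₃ : s₃.realArr 0 = x :=
    (hf₃.2 0 (by decide) (by decide) (by decide) (by decide)).trans hs₂.x
  -- Negating the abscissae and reversing their order makes them increase again, so the envelope
  -- program applies to the reflected path.
  have hx₄ : ∀ i j, i < j → j < n → s₄.realArr 10 i < s₄.realArr 10 j := by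
    intro i j hij hj
    rw [(hm₄ i (hij.trans hj)).1, (hm₄ j hj).1, hx₃]
    exact neg_lt_neg (hT.lt _ _ (by omega) (by omega))
  refine (reaches_envelopeProgram hx₄ hn (by decide) (by decide) (by decide) hn₄ rfl
    rfl).seq fun s₅ ⟨hf₅, he₅⟩ => ?_
  refine (reaches_minimumProgram hn (hf₅.1.trans hn₄)).seq fun s₆ ⟨hf₆, hk, hd, hmin⟩ => ?_
  refine (Program.LoopFree.reaches (by simp [raiseProgram, Program.LoopFree]) s₆).mono
    (Nat.le_mul_of_pos_right _ hn) ?_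
  rintro s₇ rfl
  have h₅ : ∀ a, a < 5 ∨ a = 8 → s₅.realArr a = s₃.realArr a := fun a ha =>
    (hf₅.2 a (by omega) (by omega) (by omega) (by omega)).trans (hf₄ a (by omega) (by omega))
  have h₃ : ∀ a, a < 5 → s₃.realArr a = s₂.realArr a := fun a ha =>
    hf₃.2 a (by omega) (by omega) (by omega) (by omega)
  have ht : s₅.realArr 2 = t :=
    ((h₅ 2 (by decide)).trans (h₃ 2 (by decide))).trans hs₂.top
  have hy₅ : s₅.realArr 3 = s₂.realArr 3 := (h₅ 3 (by decide)).trans (h₃ 3 (by decide))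
  rw [hx₃, h₃ 3 (by decide)] at hm₄
  rw [ht, h₅ 8 (by decide)] at hd hmin
  refine ⟨s₂.realArr 3, s₃.realArr 8, s₅.realArr 9, s₄.realArr 10, s₄.realArr 11, s₆.natVar 1, hy,
    he₃, hm₄, he₅, hk, ?_, ?_, ?_, ?_⟩
  · simp [raiseProgram, Program.run]
  · simpa [raiseProgram, Program.run] using hd
  · rw [← hd]
    exact hmin
  · simp [raiseProgram, Program.run, NatExpr.eval, RealExpr.eval, hf₆, ht, hy₅]

end RealRAM

/-! ### Shortest paths: existence, tautness and uniqueness -/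

namespace ImpreciseTerrain

section LocalChange

/-- The quotient is the derivative of the edge length with respect to the height difference. It
equals the sine of the angle of inclination, which increases with the slope. -/
theorem div_sqrt_lt_div_sqrt {d e u v : ℝ} (hd : 0 < d) (he : 0 < e) (h : u / d < v / e) :
    u / √(d ^ 2 + u ^ 2) < v / √(e ^ 2 + v ^ 2) := by
  have key : ∀ {d : ℝ}, 0 < d → ∀ u, u / √(d ^ 2 + u ^ 2) = Real.sin (Real.arctan (u / d)) := by
    intro d hd u
    have : d ^ 2 + u ^ 2 = d ^ 2 * (1 + (u / d) ^ 2) := by field_simp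
    rw [Real.sin_arctan, this, Real.sqrt_mul (by positivity), Real.sqrt_sq hd.le, div_div]
  rw [key hd, key he]
  exact Real.strictMonoOn_sin
    ⟨(Real.neg_pi_div_two_lt_arctan _).le, (Real.arctan_lt_pi_div_two _).le⟩
    ⟨(Real.neg_pi_div_two_lt_arctan _).le, (Real.arctan_lt_pi_div_two _).le⟩
    (Real.arctan_strictMono h)

/-- The graph of the convex function `v ↦ √(d ^ 2 + v ^ 2)` lies above its tangent at `u`; by
Cauchy–Schwarz. -/
theorem sqrt_add_le_sqrt {d : ℝ} (hd : 0 < d) (u v : ℝ) :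
    √(d ^ 2 + u ^ 2) + u / √(d ^ 2 + u ^ 2) * (v - u) ≤ √(d ^ 2 + v ^ 2) := by
  have hpos : 0 < √(d ^ 2 + u ^ 2) := Real.sqrt_pos.2 (by positivity)
  have hsq : √(d ^ 2 + u ^ 2) ^ 2 = d ^ 2 + u ^ 2 := Real.sq_sqrt (by positivity)
  have hcs : d ^ 2 + u * v ≤ √(d ^ 2 + v ^ 2) * √(d ^ 2 + u ^ 2) := by
    rw [← Real.sqrt_mul (by positivity)]
    refine Real.le_sqrt_of_sq_le ?_
    nlinarith [mul_nonneg (sq_nonneg d) (sq_nonneg (u - v))]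
  have : √(d ^ 2 + u ^ 2) + u / √(d ^ 2 + u ^ 2) * (v - u) =
      (√(d ^ 2 + u ^ 2) ^ 2 + u * (v - u)) / √(d ^ 2 + u ^ 2) := by
    field_simp
  rw [this, div_le_iff₀ hpos, hsq]
  linarith

/-- A vertex below the segment between its neighbours can be raised so that the path becomes
shorter. -/
theorem exists_shorter {d e y₀ y₁ y₂ t : ℝ} (hd : 0 < d) (he : 0 < e) (ht : y₁ < t)
    (h : (y₁ - y₀) / d < (y₂ - y₁) / e) :
    ∃ c, y₁ < c ∧ c < t ∧ √(d ^ 2 + (c - y₀) ^ 2) + √(e ^ 2 + (y₂ - c) ^ 2) <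
      √(d ^ 2 + (y₁ - y₀) ^ 2) + √(e ^ 2 + (y₂ - y₁) ^ 2) := by
  have hm : y₁ < (y₀ * e + y₂ * d) / (d + e) := by
    rw [div_lt_div_iff₀ hd he] at h
    rw [lt_div_iff₀ (by positivity)]
    linarith
  -- The new height stays below the chord of the neighbours, so the bend keeps its direction. The
  -- tangent inequalities at `c` then bound the gain from below by `c - y₁` times a positive
  -- difference of sines.
  obtain ⟨c, hc1, hc2⟩ := exists_between (lt_min ht hm)
  have hcm := hc2.trans_le (min_le_right _ _)
  refine ⟨c, hc1, hc2.trans_le (min_le_left _ _), ?_⟩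
  have hc : (c - y₀) / d < (y₂ - c) / e := by
    rw [lt_div_iff₀ (by positivity)] at hcm
    rw [div_lt_div_iff₀ hd he]
    linarith
  have h1 := sqrt_add_le_sqrt hd (c - y₀) (y₁ - y₀)
  have h2 := sqrt_add_le_sqrt he (y₂ - c) (y₂ - y₁)
  have h3 := div_sqrt_lt_div_sqrt hd he hc
  have h4 := mul_pos (sub_pos.2 h3) (sub_pos.2 hc1)
  linarith

/-- A vertex above the segment between its neighbours can be lowered so that the path becomes
shorter. -/
theorem exists_shorter' {d e y₀ y₁ y₂ b : ℝ} (hd : 0 < d) (he : 0 < e) (hb : b < y₁)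
    (h : (y₂ - y₁) / e < (y₁ - y₀) / d) :
    ∃ c, b < c ∧ c < y₁ ∧ √(d ^ 2 + (c - y₀) ^ 2) + √(e ^ 2 + (y₂ - c) ^ 2) <
      √(d ^ 2 + (y₁ - y₀) ^ 2) + √(e ^ 2 + (y₂ - y₁) ^ 2) := by
  have hneg : ∀ u v w : ℝ, (-u - -v) / w = -((u - v) / w) := by intros; ring
  obtain ⟨c, h1, h2, h3⟩ := exists_shorter (y₀ := -y₀) (y₂ := -y₂) hd he (neg_lt_neg hb)
    (by rw [hneg, hneg]; exact neg_lt_neg h)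
  refine ⟨-c, by linarith, by linarith, ?_⟩
  have e1 : ∀ u v : ℝ, (u - -v) ^ 2 = (-u - v) ^ 2 := by intros; ring
  have e2 : ∀ u v : ℝ, (-u - -v) ^ 2 = (u - v) ^ 2 := by intros; ring
  rw [e1, e2, e2] at h3
  rwa [e1]

end LocalChange

variable {n : ℕ}

/-- The sequence of the values of a function on `Fin n`, continued by zeros. -/
noncomputable def toSeq (f : Fin n → ℝ) (k : ℕ) : ℝ := if hk : k < n then f ⟨k, hk⟩ else 0

theorem toSeq_of_lt (f : Fin n → ℝ) {k : ℕ} (hk : k < n) : toSeq f k = f ⟨k, hk⟩ := dif_pos hk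

theorem toSeq_val (f : Fin n → ℝ) (i : Fin n) : toSeq f i = f i := dif_pos i.2

theorem isIntervals (T : ImpreciseTerrain n) :
    IsIntervals n (toSeq T.x) (toSeq T.bot) (toSeq T.top) where
  lt i j hij hj := by
    rw [toSeq_of_lt _ (hij.trans hj), toSeq_of_lt _ hj]
    exact T.strictMono_x hij
  le i hi := by
    rw [toSeq_of_lt _ hi, toSeq_of_lt _ hi]
    exact T.bot_le_top _

theorem toSeq_update (f : Fin n → ℝ) (i : Fin n) (c : ℝ) :
    toSeq (Function.update f i c) = Function.update (toSeq f) i c := by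
  funext k
  by_cases hk : k = i
  · subst hk
    rw [toSeq_val, Function.update_self, Function.update_self]
  · rw [Function.update_of_ne hk]
    by_cases hkn : k < n
    · rw [toSeq_of_lt _ hkn, toSeq_of_lt _ hkn, Function.update_of_ne]
      exact fun h => hk (congrArg Fin.val h)
    · simp [toSeq, hkn]

/-- The length of the `i`-th edge. -/
noncomputable def edgeLength (x y : ℕ → ℝ) (i : ℕ) : ℝ :=
  √((x (i + 1) - x i) ^ 2 + (y (i + 1) - y i) ^ 2)

theorem pathLength_eq (T : ImpreciseTerrain n) (y : Fin n → ℝ) :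
    T.pathLength y = ∑ i ∈ Finset.range (n - 1), edgeLength (toSeq T.x) (toSeq y) i := by
  have h : T.pathLength y = ∑ i ∈ Finset.range n,
      if i + 1 < n then edgeLength (toSeq T.x) (toSeq y) i else 0 := by
    rw [← Fin.sum_univ_eq_sum_range
      (fun i => if i + 1 < n then edgeLength (toSeq T.x) (toSeq y) i else 0)]
    refine Finset.sum_congr rfl fun i _ => ?_
    by_cases hi : (i : ℕ) + 1 < n
    · rw [dif_pos hi, if_pos hi, edgeLength, toSeq_of_lt _ hi, toSeq_of_lt _ hi, toSeq_val,
        toSeq_val]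
    · rw [dif_neg hi, if_neg hi]
  rw [h]
  cases n with
  | zero => simp
  | succ n =>
    rw [Finset.sum_range_succ, if_neg (lt_irrefl _), add_zero]
    refine Finset.sum_congr rfl fun i hi => if_pos ?_
    simpa using hi

theorem sum_edgeLength_update {x y : ℕ → ℝ} {i : ℕ} (hi : i + 2 < n) (c : ℝ) :
    ∑ j ∈ Finset.range (n - 1), edgeLength x (Function.update y (i + 1) c) j -
      ∑ j ∈ Finset.range (n - 1), edgeLength x y j =
    (√((x (i + 1) - x i) ^ 2 + (c - y i) ^ 2) +
      √((x (i + 2) - x (i + 1)) ^ 2 + (y (i + 2) - c) ^ 2)) -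
    (√((x (i + 1) - x i) ^ 2 + (y (i + 1) - y i) ^ 2) +
      √((x (i + 2) - x (i + 1)) ^ 2 + (y (i + 2) - y (i + 1)) ^ 2)) := by
  rw [← Finset.sum_sub_distrib, ← Finset.sum_subset (s₁ := {i, i + 1}), Finset.sum_pair (by simp)]
  · simp only [edgeLength, Function.update_self, add_assoc]
    rw [Function.update_of_ne (by omega), Function.update_of_ne (by omega)]
    norm_num
    ring
  · intro j hj
    simp at hj ⊢
    omega
  · intro j _ hj
    simp at hj
    simp only [edgeLength]
    rw [Function.update_of_ne (by omega), Function.update_of_ne (by omega), sub_self]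

theorem IsTopToTop.update {T : ImpreciseTerrain n} {y : Fin n → ℝ} (h : T.IsTopToTop y)
    {i : Fin n} {c : ℝ} (hi : (i : ℕ) ≠ 0) (hin : (i : ℕ) + 1 ≠ n) (hb : T.bot i ≤ c)
    (ht : c ≤ T.top i) : T.IsTopToTop (Function.update y i c) := by
  refine ⟨fun j => ?_, fun j hj => ?_, fun j hj => ?_⟩
  · by_cases hij : j = i
    · subst hij
      rw [Function.update_self]
      exact ⟨hb, ht⟩
    · rw [Function.update_of_ne hij]
      exact h.1 j
  · rw [Function.update_of_ne (by rintro rfl; exact hi hj)]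
    exact h.2.1 j hj
  · rw [Function.update_of_ne (by rintro rfl; exact hin hj)]
    exact h.2.2 j hj

/-- Changing one interior vertex within its interval affects only its two edges, so minimality
excludes the shortenings of `exists_shorter` and `exists_shorter'`. -/
theorem IsShortestPath.isTaut {T : ImpreciseTerrain n} {y : Fin n → ℝ} (hn : 0 < n)
    (h : T.IsShortestPath y) :
    IsTaut n (toSeq T.x) (toSeq T.bot) (toSeq T.top) (toSeq y) := by
  have hmin : ∀ i (hi : i + 2 < n) c, T.bot ⟨i + 1, by omega⟩ ≤ c → c ≤ T.top ⟨i + 1, by omega⟩ →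
      √((toSeq T.x (i + 1) - toSeq T.x i) ^ 2 + (toSeq y (i + 1) - toSeq y i) ^ 2) +
        √((toSeq T.x (i + 2) - toSeq T.x (i + 1)) ^ 2 +
          (toSeq y (i + 2) - toSeq y (i + 1)) ^ 2) ≤
      √((toSeq T.x (i + 1) - toSeq T.x i) ^ 2 + (c - toSeq y i) ^ 2) +
        √((toSeq T.x (i + 2) - toSeq T.x (i + 1)) ^ 2 + (toSeq y (i + 2) - c) ^ 2) := by
    intro i hi c hb ht
    have h1 := h.2 _ (h.1.update (i := ⟨i + 1, by omega⟩) (Nat.succ_ne_zero i)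
      (by simp only; omega) hb ht)
    rw [pathLength_eq, pathLength_eq, toSeq_update] at h1
    have h2 := sum_edgeLength_update (x := toSeq T.x) (y := toSeq y) hi c
    linarith
  have hx := T.isIntervals.lt
  refine ⟨?_, ?_, ?_, ?_, ?_, ?_⟩
  · intro i hi
    rw [toSeq_of_lt _ hi, toSeq_of_lt _ hi]
    exact (h.1.1 _).1
  · intro i hi
    rw [toSeq_of_lt _ hi, toSeq_of_lt _ hi]
    exact (h.1.1 _).2
  · rw [toSeq_of_lt _ hn, toSeq_of_lt _ hn]
    exact h.1.2.1 _ rfl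
  · have hlt : n - 1 < n := by omega
    rw [toSeq_of_lt _ hlt, toSeq_of_lt _ hlt]
    exact h.1.2.2 _ (by simp only; omega)
  · intro i hi hlt
    by_contra! hc
    obtain ⟨c, h1, h2, h3⟩ := exists_shorter (sub_pos.2 (hx i (i + 1) (by omega) (by omega)))
      (sub_pos.2 (hx (i + 1) (i + 2) (by omega) hi)) hlt hc
    have hi1 : i + 1 < n := by omega
    rw [toSeq_of_lt _ hi1] at h1 h2
    exact absurd (hmin i hi c ((h.1.1 _).1.trans h1.le) h2.le) (not_le.2 h3)
  · intro i hi hlt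
    by_contra! hc
    obtain ⟨c, h1, h2, h3⟩ := exists_shorter' (sub_pos.2 (hx i (i + 1) (by omega) (by omega)))
      (sub_pos.2 (hx (i + 1) (i + 2) (by omega) hi)) hlt hc
    have hi1 : i + 1 < n := by omega
    rw [toSeq_of_lt _ hi1] at h1 h2
    exact absurd (hmin i hi c h1.le (h2.le.trans (h.1.1 _).2)) (not_le.2 h3)

theorem continuous_pathLength (T : ImpreciseTerrain n) : Continuous T.pathLength := by
  refine continuous_finsetSum _ fun i _ => ?_
  by_cases hi : (i : ℕ) + 1 < n
  · simp only [dif_pos hi]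
    fun_prop
  · simp only [dif_neg hi]
    fun_prop

/-- The admissible heights form a product of compact intervals, degenerate at both ends, and the
length is continuous. -/
theorem exists_isShortestPath (T : ImpreciseTerrain n) : ∃ y, T.IsShortestPath y := by
  have hset : {y | T.IsTopToTop y} = Set.univ.pi fun i : Fin n =>
      Set.Icc (if (i : ℕ) = 0 ∨ (i : ℕ) + 1 = n then T.top i else T.bot i) (T.top i) := by
    ext y
    simp only [Set.mem_ofPred_eq, Set.mem_univ_pi, Set.mem_Icc]
    constructor
    · intro h i
      refine ⟨?_, (h.1 i).2⟩
      split_ifs with hi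
      · rcases hi with hi | hi
        · exact (h.2.1 i hi).ge
        · exact (h.2.2 i hi).ge
      · exact (h.1 i).1
    · intro h
      refine ⟨fun i => ⟨le_trans ?_ (h i).1, (h i).2⟩, fun i hi => ?_, fun i hi => ?_⟩
      · split_ifs
        · exact T.bot_le_top i
        · exact le_rfl
      · have := h i
        rw [if_pos (Or.inl hi)] at this
        exact le_antisymm this.2 this.1
      · have := h i
        rw [if_pos (Or.inr hi)] at this
        exact le_antisymm this.2 this.1
  have hcomp : IsCompact {y | T.IsTopToTop y} := by
    rw [hset]
    exact isCompact_univ_pi fun i => isCompact_Icc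
  obtain ⟨y, hy, hmin⟩ := hcomp.exists_isMinOn
    ⟨T.top, fun i => ⟨T.bot_le_top i, le_rfl⟩, fun _ _ => rfl, fun _ _ => rfl⟩
    T.continuous_pathLength.continuousOn
  exact ⟨y, hy, fun z hz => hmin hz⟩

theorem existsUnique_isShortestPath (T : ImpreciseTerrain n) (hn : 0 < n) :
    ∃! y, T.IsShortestPath y := by
  obtain ⟨y, hy⟩ := T.exists_isShortestPath
  refine ⟨y, hy, fun z hz => funext fun i => ?_⟩
  have := (hz.isTaut hn).eq T.isIntervals (hy.isTaut hn) i.2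
  rwa [toSeq_val, toSeq_val] at this

end ImpreciseTerrain

/-! ### Edge lines of taut paths, reflection, and rays above a polyline -/

namespace ImpreciseTerrain

noncomputable section

section Sequences

variable {n : ℕ} {x b t y z : ℕ → ℝ}

/-- Clearing the denominator leaves an inequality that is affine in the two heights, so edges of
different realizations over the same intervals can be compared. -/
theorem edgeLine_le_iff {j : ℕ} (hx : x j < x (j + 1)) {X w : ℝ} :
    edgeLine x y j X ≤ w ↔ (y j - w) * (x (j + 1) - X) ≤ (y (j + 1) - w) * (x j - X) := by
  have h : edgeLine x y j X =
      (y j * (x (j + 1) - X) + y (j + 1) * (X - x j)) / (x (j + 1) - x j) := by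
    have : x (j + 1) - x j ≠ 0 := by linarith
    rw [edgeLine, edgeSlope]
    field_simp
    ring
  rw [h, div_le_iff₀ (by linarith)]
  constructor <;> intro h <;> linarith

/-- If the lines extending the edges, to the right of the `i`-th vertex, of some realization pass
below a point that is not below the top of the `i`-th interval, then so do the ones of the taut
path. -/
theorem IsTaut.edgeLine_le_right (hT : IsIntervals n x b t) (hy : IsTaut n x b t y)
    (hzb : ∀ k, k < n → b k ≤ z k) (hzt : ∀ k, k < n → z k ≤ t k) {i : ℕ} {w : ℝ} (hw : t i ≤ w)
    (hz : ∀ j, i ≤ j → j + 1 < n → edgeLine x z j (x i) ≤ w) :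
    ∀ j, i ≤ j → j + 1 < n → edgeLine x y j (x i) ≤ w := by
  have hx := hT.lt
  have hfirst : ∀ j, i = j → j + 1 < n → edgeLine x y j (x i) ≤ w := by
    rintro j rfl hj
    rw [edgeLine_left]
    exact (hy.le_top i (by omega)).trans hw
  -- Induction from the right end. If `y` were below `z` at `k + 1`, it would be concave there, so
  -- the line of the next edge would also be above `w`. By induction `z` is not above `y` at `k +
  -- 2`, so the line of the next edge of `z` would be even higher over `x i`, contrary to `hz`.
  have forward : ∀ m k, k + 1 + m = n - 1 → i < k → w < edgeLine x y k (x i) →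
      z (k + 1) ≤ y (k + 1) := by
    intro m
    induction m with
    | zero =>
      intro k hk _ _
      rw [show k + 1 = n - 1 by omega, hy.last]
      exact hzt _ (by omega)
    | succ m ih =>
      intro k hk hik hline
      by_contra! hlt
      have h1 := hy.concave k (by omega) (hlt.trans_le (hzt _ (by omega)))
      have x1 := hx i (k + 1) (by omega) (by omega)
      have x2 := hx (k + 1) (k + 2) (by omega) (by omega)
      have hline' : w < edgeLine x y (k + 1) (x i) := by
        rw [edgeLine_sub k (x i) (x (k + 1)), edgeLine_right hx (by omega)] at hline
        rw [edgeLine_sub (k + 1) (x i) (x (k + 1)), edgeLine_left]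
        have : edgeSlope x y (k + 1) ≤ edgeSlope x y k := h1
        nlinarith
      have h2 := ih (k + 1) (by omega) (by omega) hline'
      have h3 := hz (k + 1) (by omega) (by omega)
      rw [← not_le, edgeLine_le_iff x2] at hline'
      rw [edgeLine_le_iff x2] at h3
      have h4 := mul_pos (sub_pos.2 hlt) (sub_pos.2 (x1.trans x2))
      have h5 := mul_nonneg (sub_nonneg.2 h2) (sub_pos.2 x1).le
      nlinarith
  -- Likewise towards vertex `i`: if `y` were above `z`, it would be convex there, so the line of
  -- the preceding edge would be above `w` as well. At edge `i` this is impossible, since its line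
  -- has height `y i ≤ t i ≤ w` over `x i`.
  have backward : ∀ m, i + 1 + m + 1 < n → w < edgeLine x y (i + 1 + m) (x i) →
      y (i + 1 + m) ≤ z (i + 1 + m) := by
    intro m
    induction m with
    | zero =>
      intro hn hline
      by_contra! hlt
      have h1 := hy.convex i (by omega) ((hzb _ (by omega)).trans_lt hlt)
      have h2 := hfirst i rfl (by omega)
      have x1 := hx i (i + 1) (by omega) (by omega)
      rw [edgeLine_sub i (x i) (x (i + 1)), edgeLine_right hx (by omega)] at h2
      rw [edgeLine_sub (i + 1) (x i) (x (i + 1)), edgeLine_left] at hline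
      have : edgeSlope x y i ≤ edgeSlope x y (i + 1) := h1
      nlinarith
    | succ m ih =>
      intro hn hline
      by_contra! hlt
      have h1 := hy.convex (i + 1 + m) (by omega) ((hzb _ (by omega)).trans_lt hlt)
      have x0 := hx i (i + 1 + m) (by omega) (by omega)
      have x1 := hx (i + 1 + m) (i + 1 + m + 1) (by omega) (by omega)
      have hline' : w < edgeLine x y (i + 1 + m) (x i) := by
        rw [edgeLine_sub _ (x i) (x (i + 1 + m + 1)), edgeLine_right hx (by omega)]
        rw [← add_assoc, edgeLine_sub (i + 1 + m + 1) (x i) (x (i + 1 + m + 1)),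
          edgeLine_left] at hline
        have : edgeSlope x y (i + 1 + m) ≤ edgeSlope x y (i + 1 + m + 1) := h1
        nlinarith
      have h2 := ih (by omega) hline'
      have h3 := hz (i + 1 + m) (by omega) (by omega)
      rw [← not_le, edgeLine_le_iff x1] at hline'
      rw [edgeLine_le_iff x1] at h3
      have h4 := mul_pos (sub_pos.2 hlt) (sub_pos.2 x0)
      have h5 := mul_nonneg (sub_nonneg.2 h2) (sub_pos.2 (x0.trans x1)).le
      rw [← add_assoc] at h4
      nlinarith
  intro j hij hj
  rcases hij.eq_or_lt with h | hij
  · exact hfirst j h hj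
  by_contra! hline
  -- The edge of `z` starts no lower and ends no higher than that of `y`; extended to the left, its
  -- line is at least as high, hence also above `w`.
  have h1 := forward (n - 1 - (j + 1)) j (by omega) hij hline
  have h2 := backward (j - (i + 1)) (by omega) (by
    rwa [show i + 1 + (j - (i + 1)) = j by omega])
  rw [show i + 1 + (j - (i + 1)) = j by omega] at h2
  have h3 := hz j hij.le hj
  have x0 := hx i j hij (by omega)
  have x1 := hx j (j + 1) (by omega) hj
  rw [← not_le, edgeLine_le_iff x1] at hline
  rw [edgeLine_le_iff x1] at h3
  have h4 := mul_nonneg (sub_nonneg.2 h1) (sub_pos.2 x0).le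
  have h5 := mul_nonneg (sub_nonneg.2 h2) (sub_pos.2 (x0.trans x1)).le
  nlinarith

/-- The sequence of the first `n` values in reverse order. -/
def mirror (n : ℕ) (f : ℕ → ℝ) (k : ℕ) : ℝ := f (n - 1 - k)

theorem mirror_mirror (f : ℕ → ℝ) {k : ℕ} (hk : k < n) :
    mirror n f (n - 1 - k) = f k := by
  rw [mirror, show n - 1 - (n - 1 - k) = k by omega]

/-- Edge `i` of the reflection is edge `n - 2 - i` traversed backwards. Slopes change sign and
order, so the direction of every bend is preserved. -/
theorem mirror_slope {i : ℕ} (hi : i + 1 < n) :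
    (mirror n y (i + 1) - mirror n y i) / ((-mirror n x) (i + 1) - (-mirror n x) i) =
      - edgeSlope x y (n - 2 - i) := by
  simp only [mirror, edgeSlope, Pi.neg_apply]
  rw [show n - 1 - (i + 1) = n - 2 - i by omega, show n - 1 - i = n - 2 - i + 1 by omega,
    ← div_neg, ← neg_div_neg_eq]
  congr 1 <;> ring

theorem edgeLine_mirror (hx : ∀ i j, i < j → j < n → x i < x j) {i : ℕ} (hi : i + 1 < n) (X : ℝ) :
    edgeLine (-mirror n x) (mirror n y) i (-X) = edgeLine x y (n - 2 - i) X := by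
  rw [edgeLine_sub (n - 2 - i) X (x (n - 2 - i + 1)), edgeLine_right hx (by omega), edgeLine,
    edgeSlope, mirror_slope hi]
  simp only [mirror, Pi.neg_apply]
  rw [show n - 1 - i = n - 2 - i + 1 by omega]
  ring

theorem IsIntervals.mirror (hT : IsIntervals n x b t) :
    IsIntervals n (-mirror n x) (mirror n b) (mirror n t) where
  lt i j hij hj := neg_lt_neg (hT.lt _ _ (by omega) (by omega))
  le i hi := hT.le _ (by omega)

theorem IsTaut.mirror (hy : IsTaut n x b t y) :
    IsTaut n (-mirror n x) (mirror n b) (mirror n t) (mirror n y) where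
  bot_le i hi := hy.bot_le _ (by omega)
  le_top i hi := hy.le_top _ (by omega)
  first := hy.last
  last := by
    simpa [ImpreciseTerrain.mirror] using hy.first
  concave i hi hlt := by
    rw [mirror_slope (i := i + 1) hi, mirror_slope (by omega)]
    have := hy.concave (n - 2 - (i + 1)) (by omega)
    simp only [ImpreciseTerrain.mirror] at hlt
    rw [show n - 1 - (i + 1) = n - 2 - (i + 1) + 1 by omega] at hlt
    have h := this hlt
    rw [show n - 2 - i = n - 2 - (i + 1) + 1 by omega]
    exact neg_le_neg h
  convex i hi hlt := by
    rw [mirror_slope (i := i + 1) hi, mirror_slope (by omega)]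
    have := hy.convex (n - 2 - (i + 1)) (by omega)
    simp only [ImpreciseTerrain.mirror] at hlt
    rw [show n - 1 - (i + 1) = n - 2 - (i + 1) + 1 by omega] at hlt
    have h := this hlt
    rw [show n - 2 - i = n - 2 - (i + 1) + 1 by omega]
    exact neg_le_neg h

theorem IsTaut.edgeLine_le (hT : IsIntervals n x b t) (hy : IsTaut n x b t y)
    (hzb : ∀ k, k < n → b k ≤ z k) (hzt : ∀ k, k < n → z k ≤ t k) {i : ℕ} (hi : i < n) {w : ℝ}
    (hw : t i ≤ w) (hz : ∀ j, j + 1 < n → edgeLine x z j (x i) ≤ w) :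
    ∀ j, j + 1 < n → edgeLine x y j (x i) ≤ w := by
  intro j hj
  rcases le_or_gt i j with hij | hij
  · exact hy.edgeLine_le_right hT hzb hzt hw (fun j _ hj => hz j hj) j hij hj
  · have hxi : (-ImpreciseTerrain.mirror n x) (n - 1 - i) = - x i := by
      rw [Pi.neg_apply, mirror_mirror _ hi]
    have := hy.mirror.edgeLine_le_right hT.mirror (z := ImpreciseTerrain.mirror n z)
      (i := n - 1 - i) (w := w)
      (fun k hk => hzb _ (by omega)) (fun k hk => hzt _ (by omega))
      (by rwa [mirror_mirror _ hi]) (fun j _ hj => by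
        rw [hxi, edgeLine_mirror hT.lt hj]
        exact hz _ (by omega)) (n - 2 - j) (by omega) (by omega)
    rwa [hxi, edgeLine_mirror hT.lt (by omega), show n - 2 - (n - 2 - j) = j by omega] at this

theorem IsRightEnvelope.congr {x' y' : ℕ → ℝ} (hx : ∀ k, k < n → x' k = x k)
    (hy : ∀ k, k < n → y' k = y k) {i : ℕ} (hi : i < n) {e : ℝ}
    (h : IsRightEnvelope n x y i e) : IsRightEnvelope n x' y' i e := by
  have hline : ∀ j, j + 1 < n → edgeLine x' y' j (x' i) = edgeLine x y j (x i) := by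
    intro j hj
    have := hx (j + 1) hj
    have := hy (j + 1) hj
    have := hx j (by omega)
    have := hy j (by omega)
    simp only [edgeLine, edgeSlope, *]
  refine ⟨(hy i hi).trans_le h.vertex_le, fun j h1 h2 => ?_, ?_⟩
  · rw [hline j h2]
    exact h.line_le j h1 h2
  · rw [hy i hi]
    refine h.eq.imp_right ?_
    rintro ⟨j, h1, h2, h3⟩
    exact ⟨j, h1, h2, by rw [hline j h2, h3]⟩

/-- `d` is the height above `t`, at `X`, of the intersection of the halfplanes above the edges. -/
structure IsHeightAbove (n : ℕ) (x y : ℕ → ℝ) (X t d : ℝ) : Prop where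
  nonneg : 0 ≤ d
  line_le : ∀ j, j + 1 < n → edgeLine x y j X ≤ t + d
  eq : d = 0 ∨ ∃ j, j + 1 < n ∧ edgeLine x y j X = t + d

/-- Every edge lies to the right or to the left of the `i`-th vertex; the left ones are seen by the
envelope of the reflection at index `n - 1 - i`. -/
theorem isHeightAbove_envelopeDist (hx : ∀ i j, i < j → j < n → x i < x j) {e e' : ℕ → ℝ}
    (hyt : ∀ i, i < n → y i ≤ t i) (he : ∀ i, i < n → IsRightEnvelope n x y i (e i))
    (he' : ∀ i, i < n → IsRightEnvelope n (-mirror n x) (mirror n y) i (e' i)) {i : ℕ}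
    (hi : i < n) : IsHeightAbove n x y (x i) (t i) (RealRAM.envelopeDist n t e e' i) := by
  obtain ⟨a1, a2, a3⟩ := he i hi
  obtain ⟨b1, b2, b3⟩ := he' (n - 1 - i) (by omega)
  rw [mirror_mirror _ hi] at b1 b3
  have hxi : (-mirror n x) (n - 1 - i) = - x i := by
    rw [Pi.neg_apply, mirror_mirror _ hi]
  rw [hxi] at b2 b3
  have h1 : e i - t i ≤ RealRAM.envelopeDist n t e e' i :=
    (le_max_left _ _).trans (le_max_right _ _)
  have h2 : e' (n - 1 - i) - t i ≤ RealRAM.envelopeDist n t e e' i :=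
    (le_max_right _ _).trans (le_max_right _ _)
  have h0 : 0 ≤ RealRAM.envelopeDist n t e e' i := le_max_left _ _
  have hti := hyt i hi
  refine ⟨h0, fun j hj => ?_, ?_⟩
  · rcases le_or_gt i j with hij | hij
    · linarith [a2 j hij hj]
    · have := b2 (n - 2 - j) (by omega) (by omega)
      rw [edgeLine_mirror hx (by omega), show n - 2 - (n - 2 - j) = j by omega] at this
      linarith
  · rcases h0.eq_or_lt with h0 | h0
    · exact Or.inl h0.symm
    · right
      have hmax : RealRAM.envelopeDist n t e e' i = e i - t i ∨
          RealRAM.envelopeDist n t e e' i = e' (n - 1 - i) - t i := by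
        rcases max_choice 0 (max (e i - t i) (e' (n - 1 - i) - t i)) with h | h
        · exact absurd h h0.ne'
        · rcases max_choice (e i - t i) (e' (n - 1 - i) - t i) with h' | h'
          · exact Or.inl (h.trans h')
          · exact Or.inr (h.trans h')
      rcases hmax with h | h
      -- A positive distance cannot come from the vertex itself, which is not above the top; so an
      -- edge line attains it.
      · rcases a3 with h3 | ⟨j, _, h4, h5⟩
        · linarith
        · exact ⟨j, h4, by linarith⟩
      · rcases b3 with h3 | ⟨j, _, h4, h5⟩
        · linarith
        · rw [edgeLine_mirror hx h4] at h5
          exact ⟨n - 2 - j, by omega, by linarith⟩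

/-- Two affine functions are compared at the ends of an interval; the form with base point `X₀` and
slope `m` suits rays from a tower. -/
theorem edgeLine_le_of_le_of_le {j : ℕ} {w m X₀ X₁ X : ℝ} (h₀ : edgeLine x y j X₀ ≤ w)
    (h₁ : edgeLine x y j X₁ ≤ w + m * (X₁ - X₀)) (h : X ∈ Set.uIcc X₀ X₁) :
    edgeLine x y j X ≤ w + m * (X - X₀) := by
  rw [edgeLine_sub j X X₀]
  rw [edgeLine_sub j X₁ X₀] at h₁
  rcases le_total X₀ X₁ with hle | hle
  · rw [Set.uIcc_of_le hle] at h
    rcases le_total (edgeSlope x y j) m with hm | hm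
    · nlinarith [mul_nonneg (sub_nonneg.2 hm) (sub_nonneg.2 h.1)]
    · nlinarith [mul_nonneg (sub_nonneg.2 hm) (sub_nonneg.2 h.2)]
  · rw [Set.uIcc_of_ge hle] at h
    rcases le_total (edgeSlope x y j) m with hm | hm
    · nlinarith [mul_nonneg (sub_nonneg.2 hm) (sub_nonneg.2 h.1)]
    · nlinarith [mul_nonneg (sub_nonneg.2 hm) (sub_nonneg.2 h.2)]

/-- A ray to the right from a point above the lines extending the edges, that meets the polyline
in `Q`, is above the polyline until there. -/
theorem edgeLine_le_ray_right (hx : ∀ i j, i < j → j < n → x i < x j) {i : ℕ} {w m : ℝ}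
    (hw : ∀ j, j + 1 < n → edgeLine x y j (x i) ≤ w) {a c : ℕ} (hia : i ≤ a) (hic : i ≤ c)
    (ha : a + 1 < n) (hc : c + 1 < n) {X Q : ℝ} (hXa : x a ≤ X)
    (hXa' : X ≤ x (a + 1)) (hQ : x c ≤ Q) (hQ' : Q ≤ x (c + 1)) (hXQ : X ≤ Q)
    (h : edgeLine x y c Q ≤ w + m * (Q - x i)) : edgeLine x y a X ≤ w + m * (X - x i) := by
  have hxle : ∀ k l, k ≤ l → l < n → x k ≤ x l := fun k l hkl hl => by
    rcases hkl.eq_or_lt with rfl | hkl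
    · exact le_rfl
    · exact (hx _ _ hkl hl).le
  -- Backwards from `Q`: the line of an edge is below the ray over `x i` by `hw` and at the right
  -- end of the edge (for edge `c`, at `Q`) by the previous step, hence also at the left end of the
  -- edge.
  have hvertex : ∀ l k, k + l = c → i ≤ k → y k ≤ w + m * (x k - x i) := by
    intro l
    induction l with
    | zero =>
      rintro k rfl hik
      rw [← edgeLine_left (x := x) (y := y) k]
      have := hxle i k hik (by omega)
      exact edgeLine_le_of_le_of_le (hw _ hc) h (by
        rw [Set.uIcc_of_le (this.trans hQ)]; exact ⟨this, hQ⟩)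
    | succ l ih =>
      intro k hk hik
      have h1 := ih (k + 1) (by omega) (by omega)
      rw [← edgeLine_right (y := y) hx (by omega)] at h1
      rw [← edgeLine_left (x := x) (y := y) k]
      have x1 := hxle i k hik (by omega)
      have x2 := hxle k (k + 1) (by omega) (by omega)
      exact edgeLine_le_of_le_of_le (hw _ (by omega)) h1 (by
        rw [Set.uIcc_of_le (x1.trans x2)]; exact ⟨x1, x2⟩)
  have hiX := (hxle i a hia (by omega)).trans hXa
  rcases lt_trichotomy a c with hac | rfl | hac
  · have h1 := hvertex (c - (a + 1)) (a + 1) (by omega) (by omega)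
    rw [← edgeLine_right (y := y) hx ha] at h1
    exact edgeLine_le_of_le_of_le (hw _ ha) h1 (by
      rw [Set.uIcc_of_le (hiX.trans hXa')]; exact ⟨hiX, hXa'⟩)
  · exact edgeLine_le_of_le_of_le (hw _ ha) h (by
      rw [Set.uIcc_of_le (hiX.trans hXQ)]; exact ⟨hiX, hXQ⟩)
  -- An edge beyond the one containing `Q` is possible only if `X` and `Q` are the common vertex of
  -- the two edges.
  · have h1 := hxle (c + 1) a hac (by omega)
    have h2 : x (c + 1) = x a := by linarith
    have h3 : a = c + 1 := by
      by_contra hne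
      exact (hx (c + 1) a (by omega) (by omega)).ne h2
    subst h3
    have h4 : X = x (c + 1) := by linarith
    have h5 : Q = x (c + 1) := by linarith
    rw [h5, edgeLine_right hx hc] at h
    rwa [h4, edgeLine_left]

/-- A ray to the left from a point above the lines extending the edges, that meets the polyline
in `Q`, is above the polyline until there. -/
theorem edgeLine_le_ray_left (hx : ∀ i j, i < j → j < n → x i < x j) {i : ℕ} (hi : i < n) {w m : ℝ}
    (hw : ∀ j, j + 1 < n → edgeLine x y j (x i) ≤ w) {a c : ℕ} (hia : a < i) (hic : c < i)
    {X Q : ℝ} (hXa : x a ≤ X)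
    (hXa' : X ≤ x (a + 1)) (hQ : x c ≤ Q) (hQ' : Q ≤ x (c + 1)) (hXQ : Q ≤ X)
    (h : edgeLine x y c Q ≤ w + m * (Q - x i)) : edgeLine x y a X ≤ w + m * (X - x i) := by
  have hxi : (-mirror n x) (n - 1 - i) = - x i := by
    rw [Pi.neg_apply, mirror_mirror _ hi]
  have hmx : ∀ k, k < n → (-mirror n x) (n - 1 - k) = - x k := fun k hk => by
    rw [Pi.neg_apply, mirror_mirror _ hk]
  have key := edgeLine_le_ray_right (n := n) (x := -mirror n x) (y := mirror n y) (i := n - 1 - i)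
    (w := w) (m := -m) (a := n - 2 - a) (c := n - 2 - c) (X := -X) (Q := -Q)
    (fun k l hkl hl => neg_lt_neg (hx _ _ (by omega) (by omega)))
    (fun j hj => by
      rw [hxi, edgeLine_mirror hx hj]
      exact hw _ (by omega))
    (by omega) (by omega) (by omega) (by omega)
    (by rw [show n - 2 - a = n - 1 - (a + 1) by omega, hmx _ (by omega)]; linarith)
    (by rw [show n - 2 - a + 1 = n - 1 - a by omega, hmx _ (by omega)]; linarith)
    (by rw [show n - 2 - c = n - 1 - (c + 1) by omega, hmx _ (by omega)]; linarith)
    (by rw [show n - 2 - c + 1 = n - 1 - c by omega, hmx _ (by omega)]; linarith)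
    (by linarith)
    (by
      rw [edgeLine_mirror hx (by omega), show n - 2 - (n - 2 - c) = c by omega, hxi]
      linarith)
  rw [edgeLine_mirror hx (by omega), show n - 2 - (n - 2 - a) = a by omega, hxi] at key
  linarith

end Sequences

end

end ImpreciseTerrain

/-! ### Visibility in terms of edge lines; heights of watchtowers -/

namespace ImpreciseTerrain

variable {n : ℕ} {T : ImpreciseTerrain n} {y : Fin n → ℝ}

theorem vertex_mem_polyline (T : ImpreciseTerrain n) (y : Fin n → ℝ) (i : Fin n) :
    T.vertex y i ∈ T.polyline y := Or.inl ⟨i, rfl⟩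

theorem mem_polyline {p : ℝ × ℝ} (hp : p ∈ T.polyline y) :
    (∃ i, p = T.vertex y i) ∨ ∃ j, j + 1 < n ∧ toSeq T.x j ≤ p.1 ∧ p.1 ≤ toSeq T.x (j + 1) ∧
      p.2 = edgeLine (toSeq T.x) (toSeq y) j p.1 := by
  rcases hp with hp | ⟨i, j, hij, a, b, ha, hb, hab, rfl⟩
  · exact Or.inl hp
  · right
    have hj : (i : ℕ) + 1 < n := hij ▸ j.2
    have hlt := T.isIntervals.lt i (i + 1) (Nat.lt_succ_self _) hj
    refine ⟨i, hj, ?_⟩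
    have e1 : T.x j = toSeq T.x (i + 1) := by rw [hij, toSeq_val]
    have e2 : y j = toSeq y (i + 1) := by rw [hij, toSeq_val]
    have e3 : T.x i = toSeq T.x i := (toSeq_val _ _).symm
    have e4 : y i = toSeq y i := (toSeq_val _ _).symm
    simp only [vertex, Prod.smul_mk, Prod.mk_add_mk, smul_eq_mul, e1, e2, e3, e4]
    obtain rfl : a = 1 - b := by linarith
    refine ⟨by nlinarith, by nlinarith, ?_⟩
    have hne : toSeq T.x (i + 1) - toSeq T.x i ≠ 0 := by linarith
    rw [edgeLine, edgeSlope]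
    field_simp
    ring

theorem eq_of_mem_polyline {p : ℝ × ℝ} (hp : p ∈ T.polyline y) {i : Fin n} (h : p.1 = T.x i) :
    p.2 = y i := by
  have hx := T.isIntervals.lt
  rcases mem_polyline hp with ⟨k, rfl⟩ | ⟨j, hj, h1, h2, h3⟩
  · obtain rfl : k = i := T.strictMono_x.injective h
    rfl
  · rw [← toSeq_val T.x] at h
    rw [h] at h1 h2 h3
    rw [h3, ← toSeq_val y]
    rcases lt_trichotomy j (i : ℕ) with hji | hji | hji
    · rcases (Nat.succ_le_iff.2 hji).eq_or_lt with hji | hji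
      · rw [← hji]
        exact edgeLine_right hx hj
      · exact absurd (hx _ _ hji i.2) (not_lt.2 h2)
    · rw [hji]
      exact edgeLine_left _
    · exact absurd (hx _ _ hji (by omega)) (not_lt.2 h1)

theorem exists_edge_of_lt {p : ℝ × ℝ} (hp : p ∈ T.polyline y) {i : Fin n} (h : T.x i < p.1) :
    ∃ j, (i : ℕ) ≤ j ∧ j + 1 < n ∧ toSeq T.x j ≤ p.1 ∧ p.1 ≤ toSeq T.x (j + 1) ∧
      p.2 = edgeLine (toSeq T.x) (toSeq y) j p.1 := by
  have hx := T.isIntervals.lt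
  rcases mem_polyline hp with ⟨k, rfl⟩ | ⟨j, hj, h1, h2, h3⟩
  · have hik : (i : ℕ) < k := T.strictMono_x.lt_iff_lt.1 h
    obtain ⟨j, hj⟩ : ∃ j, (k : ℕ) = j + 1 := ⟨k - 1, by omega⟩
    have hk := k.2
    rw [hj] at hk
    refine ⟨j, by omega, hk, ?_⟩
    simp only [vertex]
    rw [← toSeq_val T.x, ← toSeq_val y, hj]
    exact ⟨(hx j (j + 1) (by omega) hk).le, le_rfl, (edgeLine_right hx hk).symm⟩
  · refine ⟨j, ?_, hj, h1, h2, h3⟩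
    by_contra! hji
    rw [← toSeq_val T.x] at h
    have := T.isIntervals.le_of_le (Nat.succ_le_iff.2 hji) i.2
    linarith

theorem exists_edge_of_gt {p : ℝ × ℝ} (hp : p ∈ T.polyline y) {i : Fin n} (h : p.1 < T.x i) :
    ∃ j, j < (i : ℕ) ∧ toSeq T.x j ≤ p.1 ∧ p.1 ≤ toSeq T.x (j + 1) ∧
      p.2 = edgeLine (toSeq T.x) (toSeq y) j p.1 := by
  have hx := T.isIntervals.lt
  rcases mem_polyline hp with ⟨k, rfl⟩ | ⟨j, hj, h1, h2, h3⟩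
  · have hik : (k : ℕ) < i := T.strictMono_x.lt_iff_lt.1 h
    refine ⟨k, hik, ?_⟩
    simp only [vertex]
    rw [← toSeq_val T.x, ← toSeq_val y]
    exact ⟨le_rfl, (hx k (k + 1) (by omega) (by omega)).le, (edgeLine_left _).symm⟩
  · refine ⟨j, ?_, h1, h2, h3⟩
    by_contra! hji
    rw [← toSeq_val T.x] at h
    have := T.isIntervals.le_of_le hji (by omega)
    linarith

/-- A point above the lines extending the edges sees the polyline. -/
theorem guards_of_edgeLine_le {i : Fin n} {w : ℝ} (hi : y i ≤ w)
    (hw : ∀ j, j + 1 < n → edgeLine (toSeq T.x) (toSeq y) j (T.x i) ≤ w) :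
    T.Guards y (T.x i, w) := by
  have hx := T.isIntervals.lt
  rw [← toSeq_val T.x] at hw
  rintro q hq r ⟨a, θ, ha, hθ, hab, rfl⟩ z hz hzr
  obtain rfl : a = 1 - θ := by linarith
  simp only [Prod.smul_fst, Prod.fst_add, Prod.smul_snd, Prod.snd_add, smul_eq_mul] at hzr ⊢
  have hz1 : z.1 - T.x i = θ * (q.1 - T.x i) := by rw [hzr]; ring
  -- Over `x i` no slope of the ray is available: either the point is the start of the segment, or
  -- the segment is vertical and `q` is the `i`-th vertex.
  rcases eq_or_ne z.1 (T.x i) with hzi | hzi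
  · rw [eq_of_mem_polyline hz hzi]
    rw [hzi, sub_self, eq_comm, mul_eq_zero, sub_eq_zero] at hz1
    rcases hz1 with rfl | hqi
    · linarith
    · rw [eq_of_mem_polyline hq hqi]
      nlinarith
  · have hθ0 : 0 < θ := by
      refine hθ.lt_of_ne ?_
      rintro rfl
      exact hzi (by linarith)
    have hqi : q.1 - T.x i ≠ 0 := by
      intro h
      rw [h, mul_zero, sub_eq_zero] at hz1
      exact hzi hz1
    have hθ1 : θ ≤ 1 := by linarith
    have hray : (1 - θ) * w + θ * q.2 =
        w + (q.2 - w) / (q.1 - T.x i) * (z.1 - toSeq T.x i) := by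
      rw [toSeq_val, hz1]
      field_simp
      ring
    have hq2 : q.2 ≤ w + (q.2 - w) / (q.1 - T.x i) * (q.1 - toSeq T.x i) := by
      rw [toSeq_val, div_mul_cancel₀ _ hqi]
      linarith
    rw [hray]
    rcases hqi.lt_or_gt with hlt | hgt
    · obtain ⟨c, c1, c2, c3, c4⟩ := exists_edge_of_gt hq (sub_neg.1 hlt)
      obtain ⟨a, a1, a2, a3, a4⟩ := exists_edge_of_gt hz
        (sub_neg.1 (hz1.trans_lt (mul_neg_of_pos_of_neg hθ0 hlt)))
      rw [a4]
      exact edgeLine_le_ray_left hx i.2 hw a1 c1 a2 a3 c2 c3 (by nlinarith) (c4 ▸ hq2)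
    · obtain ⟨c, c1, c2, c3, c4, c5⟩ := exists_edge_of_lt hq (sub_pos.1 hgt)
      obtain ⟨a, a1, a2, a3, a4, a5⟩ := exists_edge_of_lt hz
        (sub_pos.1 ((mul_pos hθ0 hgt).trans_eq hz1.symm))
      rw [a5]
      exact edgeLine_le_ray_right hx hw a1 c1 a2 c2 a3 a4 c3 c4 (by nlinarith) (c5 ▸ hq2)

theorem Guards.le_of_between {i : Fin n} {w : ℝ} (h : T.Guards y (T.x i, w)) {k l : ℕ}
    (hk : k < n) (hl : l < n) {θ : ℝ} (hθ : θ ∈ Set.Icc 0 1)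
    (hx : toSeq T.x k = T.x i + θ * (toSeq T.x l - T.x i)) :
    toSeq y k ≤ w + θ * (toSeq y l - w) := by
  rw [toSeq_of_lt _ hk, toSeq_of_lt _ hl] at *
  have := h _ (vertex_mem_polyline T y ⟨l, hl⟩)
    ((1 - θ) • (T.x i, w) + θ • T.vertex y ⟨l, hl⟩)
    ⟨1 - θ, θ, by linarith [hθ.2], hθ.1, by ring, rfl⟩ _ (vertex_mem_polyline T y ⟨k, hk⟩)
  simp only [vertex, Prod.smul_mk, Prod.mk_add_mk, smul_eq_mul] at this
  linarith [this (by rw [hx]; ring)]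

/-- A guard is above the lines extending the edges. -/
theorem Guards.edgeLine_le {i : Fin n} {w : ℝ} (h : T.Guards y (T.x i, w)) (hi : y i ≤ w) :
    ∀ j, j + 1 < n → edgeLine (toSeq T.x) (toSeq y) j (T.x i) ≤ w := by
  intro j hj
  have hx := T.isIntervals.lt
  have hj1 := hx j (j + 1) (Nat.lt_succ_self j) hj
  rcases lt_trichotomy (i : ℕ) j with hij | hij | hij
  · have h0 := hx i j hij (by omega)
    rw [toSeq_val] at h0
    have hpos : 0 < toSeq T.x (j + 1) - T.x i := by linarith
    -- Visibility of the far end of the edge puts the near end under the line of sight; `θ` is the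
    -- ratio of their horizontal distances from the tower.
    have := h.le_of_between (k := j) (l := j + 1)
      (θ := (toSeq T.x j - T.x i) / (toSeq T.x (j + 1) - T.x i)) (by omega) hj
      ⟨div_nonneg (by linarith) hpos.le, (div_le_one hpos).2 (by linarith)⟩
      (by rw [div_mul_cancel₀ _ hpos.ne']; ring)
    rw [edgeLine_le_iff hj1]
    rw [← sub_le_iff_le_add', div_mul_eq_mul_div, le_div_iff₀ hpos] at this
    linarith
  · rw [← hij, ← toSeq_val T.x, edgeLine_left, toSeq_val]
    exact hi
  · rcases (Nat.succ_le_iff.2 hij).eq_or_lt with hij | hij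
    · rw [← toSeq_val T.x, ← hij]
      rw [← toSeq_val y, ← hij] at hi
      exact (edgeLine_right hx hj).trans_le hi
    · have h0 := hx (j + 1) i hij i.2
      rw [toSeq_val] at h0
      have hpos : 0 < T.x i - toSeq T.x j := by linarith
      have := h.le_of_between (k := j + 1) (l := j)
        (θ := (T.x i - toSeq T.x (j + 1)) / (T.x i - toSeq T.x j)) hj (by omega)
        ⟨div_nonneg (by linarith) hpos.le, (div_le_one hpos).2 (by linarith)⟩
        (by
          field_simp
          ring)
      rw [edgeLine_le_iff hj1]
      rw [← sub_le_iff_le_add', div_mul_eq_mul_div, le_div_iff₀ hpos] at this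
      linarith

theorem mem_visibilityPolygon {p : ℝ × ℝ} :
    p ∈ T.visibilityPolygon y ↔
      ∀ j, j + 1 < n → edgeLine (toSeq T.x) (toSeq y) j p.1 ≤ p.2 := by
  constructor
  · intro h j hj
    have := h ⟨j, by omega⟩ ⟨j + 1, hj⟩ rfl
    rw [edgeLine, edgeSlope, toSeq_of_lt _ hj, toSeq_of_lt _ hj,
      toSeq_of_lt _ (Nat.lt_of_succ_lt hj), toSeq_of_lt _ (Nat.lt_of_succ_lt hj)]
    exact this
  · intro h i j hij
    have := h i (hij ▸ j.2)
    rwa [edgeLine, edgeSlope, hij, toSeq_val, toSeq_val, toSeq_val, toSeq_val] at this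

/-- The height `t + d` belongs to the polygon. If `d` is not zero, an edge line through that height
excludes everything lower; if it is zero, absolute values are nonnegative anyway. -/
theorem IsHeightAbove.verticalDist_eq {X t d : ℝ}
    (h : IsHeightAbove n (toSeq T.x) (toSeq y) X t d) :
    verticalDist (X, t) (T.visibilityPolygon y) = d := by
  refine IsLeast.csInf_eq ⟨⟨t + d, ?_, ?_⟩, ?_⟩
  · exact mem_visibilityPolygon.2 h.line_le
  · rw [add_sub_cancel_left, abs_of_nonneg h.nonneg]
  · rintro _ ⟨b, hb, rfl⟩
    rcases h.eq with h0 | ⟨j, hj, hjd⟩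
    · rw [h0]
      exact abs_nonneg _
    · have := mem_visibilityPolygon.1 hb j hj
      refine le_trans ?_ (le_abs_self _)
      simp only at this ⊢
      linarith

theorem holdsIntervals_input (T : ImpreciseTerrain n) :
    RealRAM.HoldsIntervals n (toSeq T.x) (toSeq T.bot) (toSeq T.top) T.input where
  size := rfl
  x := by funext k; simp [input, toSeq]
  bot := by funext k; simp [input, toSeq]
  top := by funext k; simp [input, toSeq]

/-- Only edges incident to the `k`-th vertex change, and over `x k` their lines have the new height
`c`. -/
theorem edgeLine_update_le {x z : ℕ → ℝ} (hx : ∀ i j, i < j → j < n → x i < x j) {k : ℕ} {c w : ℝ}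
    (hc : c ≤ w) (h : ∀ j, j + 1 < n → edgeLine x z j (x k) ≤ w) :
    ∀ j, j + 1 < n → edgeLine x (Function.update z k c) j (x k) ≤ w := by
  intro j hj
  rcases eq_or_ne j k with rfl | hjk
  · rwa [edgeLine_left, Function.update_self]
  rcases eq_or_ne (j + 1) k with rfl | hjk'
  · rwa [edgeLine_right hx hj, Function.update_self]
  · rw [edgeLine, edgeSlope, Function.update_of_ne hjk, Function.update_of_ne hjk']
    exact h j hj

theorem IsTopToTop.isRealization_update {T : ImpreciseTerrain n} {y : Fin n → ℝ}
    (h : T.IsTopToTop y) (k : Fin n) : T.IsRealization (Function.update y k (T.top k)) := by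
  intro j
  rcases eq_or_ne j k with rfl | hjk
  · rw [Function.update_self]
    exact ⟨T.bot_le_top j, le_rfl⟩
  · rw [Function.update_of_ne hjk]
    exact h.1 j

theorem isDiscreteWatchtower_update (h : T.IsTopToTop y) {k : Fin n} {d : ℝ}
    (hd : IsHeightAbove n (toSeq T.x) (toSeq y) (T.x k) (T.top k) d) :
    T.IsDiscreteWatchtower (Function.update y k (T.top k)) k d := by
  refine ⟨h.isRealization_update k, hd.nonneg, ?_⟩
  refine guards_of_edgeLine_le (by linarith [hd.nonneg]) ?_
  rw [toSeq_update, Function.update_self, ← toSeq_val T.x]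
  refine edgeLine_update_le T.isIntervals.lt (by linarith [hd.nonneg]) ?_
  rw [toSeq_val]
  exact hd.line_le

/-- A watchtower is not lower than the distance of the top of its interval to the visibility
polygon of the taut path. -/
theorem IsDiscreteWatchtower.le
    (hy : IsTaut n (toSeq T.x) (toSeq T.bot) (toSeq T.top) (toSeq y)) {z : Fin n → ℝ} {i : Fin n}
    {h d : ℝ} (hz : T.IsDiscreteWatchtower z i h)
    (hd : IsHeightAbove n (toSeq T.x) (toSeq y) (T.x i) (T.top i) d) : d ≤ h := by
  obtain ⟨hreal, hpos, hguard⟩ := hz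
  rcases hd.eq with h0 | ⟨j, hj, hjd⟩
  · rwa [h0]
  have hline := hguard.edgeLine_le (by linarith)
  -- The tower is compared at height `h` above the top of its interval: this is not below its actual
  -- tip, so the edge lines of `z` still pass below.
  have := hy.edgeLine_le T.isIntervals (z := toSeq z) (i := i) (w := T.top i + h)
    (fun k hk => by
      rw [toSeq_of_lt _ hk, toSeq_of_lt _ hk]
      exact (hreal _).1)
    (fun k hk => by
      rw [toSeq_of_lt _ hk, toSeq_of_lt _ hk]
      exact (hreal _).2)
    i.2 (by rw [toSeq_val]; linarith)
    (fun j hj => by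
      rw [toSeq_val]
      linarith [hline j hj, (hreal i).2]) j hj
  rw [toSeq_val] at this
  linarith

end ImpreciseTerrain

/-- The first part says that there is exactly one shortest-path realization from the top of the
first interval to the top of the last one. The second part says that one real RAM program computes,
in linear time, an optimistic shortest discrete watchtower: an optimal height `h`, a base index `k`
and a realization, namely the shortest-path realization with its `k`-th vertex raised to the top of
its interval; and `h` is the minimum vertical distance from the top of an interval to the visibility
polygon of the shortest-path realization, attained at the `k`-th interval. -/
theorem mainTheorem1 :
    (∀ (n : ℕ) (T : ImpreciseTerrain n), 0 < n → ∃! y : Fin n → ℝ, T.IsShortestPath y) ∧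
    ∃ (A : RealRAM.Program) (C : ℕ), ∀ (n : ℕ) (T : ImpreciseTerrain n), 0 < n →
      ∀ y : Fin n → ℝ, T.IsShortestPath y →
        ∃ (s : RealRAM.State) (t : ℕ) (k : Fin n) (h : ℝ),
          RealRAM.Exec A T.input s t ∧ t ≤ C * n ∧
          HoldsWatchtower s (Function.update y k (T.top k)) k h ∧
          T.IsDiscreteWatchtower (Function.update y k (T.top k)) k h ∧
          IsLeast T.discreteWatchtowerHeights h ∧
          h = verticalDist (T.x k, T.top k) (T.visibilityPolygon y) ∧
          ∀ i : Fin n, h ≤ verticalDist (T.x i, T.top i) (T.visibilityPolygon y) := by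
  refine ⟨fun n T hn => T.existsUnique_isShortestPath hn, RealRAM.watchtowerProgram, ?_⟩
  obtain ⟨C, hC⟩ := RealRAM.exists_reaches_watchtowerProgram
  refine ⟨C, fun n T hn y hy => ?_⟩
  obtain ⟨s, c, hexec, hc, z, e, e', x', z', k, hz, he, hm, he', hk, hsk, hsh, hmin, hsz⟩ :=
    hC n _ _ _ _ T.isIntervals hn T.holdsIntervals_input
  have hyt := hy.isTaut hn
  -- The computed path is only known to be taut; uniqueness of taut paths identifies it with the
  -- shortest one.
  have hzy : ∀ i, i < n → ImpreciseTerrain.toSeq y i = z i :=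
    fun i hi => hyt.eq T.isIntervals hz hi
  have hd : ∀ i : Fin n, ImpreciseTerrain.IsHeightAbove n (ImpreciseTerrain.toSeq T.x)
      (ImpreciseTerrain.toSeq y) (T.x i) (T.top i)
      (RealRAM.envelopeDist n (ImpreciseTerrain.toSeq T.top) e e' i) := by
    intro i
    have := ImpreciseTerrain.isHeightAbove_envelopeDist T.isIntervals.lt hyt.le_top
      (fun i hi => (he i hi).congr (fun _ _ => rfl) hzy hi)
      (fun i hi => (he' i hi).congr (fun k hk => (hm k hk).1.symm)
        (fun k hk => (hzy _ (by omega)).trans (hm k hk).2.symm) hi) i.2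
    rwa [ImpreciseTerrain.toSeq_val, ImpreciseTerrain.toSeq_val] at this
  refine ⟨s, c, ⟨k, hk⟩, _, hexec, hc, ⟨hsk, hsh, fun i => ?_⟩,
    ImpreciseTerrain.isDiscreteWatchtower_update hy.1 (hd ⟨k, hk⟩),
    ⟨⟨_, _, ImpreciseTerrain.isDiscreteWatchtower_update hy.1 (hd ⟨k, hk⟩)⟩, ?_⟩,
    (hd ⟨k, hk⟩).verticalDist_eq.symm, fun i => ?_⟩
  · rw [hsz]
    rcases eq_or_ne i ⟨k, hk⟩ with rfl | hik
    · rw [Function.update_self, Function.update_self, ImpreciseTerrain.toSeq_of_lt _ hk]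
    · rw [Function.update_of_ne hik, Function.update_of_ne (fun h => hik (Fin.ext h)),
        ← hzy _ i.2, ImpreciseTerrain.toSeq_val]
  · rintro h ⟨w, i, hw⟩
    exact (hmin i i.2).trans (hw.le hyt (hd i))
  · rw [(hd i).verticalDist_eq]
    exact hmin i i.2
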